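/- Let $V$ be a real Banach space and let $V_{\mathbb C}=V+iV$ be its complexification, a complex Banach space with norm $\|x+iy\|=\sup_{\theta\in\mathbb R}\|\cos\theta\,x-\sin\theta\,y\|$. Let $C:V_{\mathbb C}\to V_{\mathbb C}$, $C(x+iy)=x-iy$ for $x,y\in V$, and for a bounded complex-linear operator $S\in\mathcal B(V_{\mathbb C})$ put $S^\flat=CSC$. For a bounded real-linear operator $T\in\mathcal B(V)$ let $T_{\mathbb C}(x+iy)=Tx+iTy$ and $$\sigma_{\mathbb C}(T)=\{u+iv:\ u,v\in\mathbb R,\ (u-T)^2+v^2 \text{ is not invertible in } \mathcal B(V)\}.$$ For an open set $U\subset\mathbb C$, a *Cauchy domain in $U$* is an open set $\Delta$ with $\overline\Delta\subset U$ whose boundary is the union of a finite (possibly empty) family $\Gamma$ of piecewise continuously differentiable closed curves, positively oriented, that is, the total winding number of $\Gamma$ is $1$ about every point of $\Delta$ and $0$ about every point outside $\overline\Delta$. **Theorem.** Let $U\subset\mathbb C$ be open and conjugate symmetric ($\zeta\in U$ implies $\bar\zeta\in U$), let $F:U\to\mathcal B(V_{\mathbb C})$ be analytic with $F(\zeta)^\flat=F(\bar\zeta)$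 for all $\zeta\in U$, and let $T\in\mathcal B(V)$ satisfy $\sigma_{\mathbb C}(T)\subset U$. Then there is a Cauchy domain $\Delta$ in $U$ with $\sigma(T_{\mathbb C})\subset\Delta$; the operator $$F(T_{\mathbb C})=\frac1{2\pi i}\int_\Gamma F(\zeta)(\zeta-T_{\mathbb C})^{-1}\,d\zeta$$ is the same for every Cauchy domain $\Delta$ in $U$ containing $\sigma(T_{\mathbb C})$, with boundary family $\Gamma$; and $$F(T_{\mathbb C})^\flat=F(T_{\mathbb C}).$$ Hence $F(T_{\mathbb C})$ leaves $V$ invariant: $F(T_{\mathbb C})(V)\subset V$. -/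

import Mathlib

/-! ### The complexification of a real Banach space -/

/-- The complexification `V_ℂ = V + iV` of a real vector space: the element `⟨x, y⟩` is `x + iy`. -/
@[ext]
structure Complexification (V : Type*) where
  /-- The real part `x` of `x + iy`. -/
  re : V
  /-- The imaginary part `y` of `x + iy`. -/
  im : V

namespace Complexification

section Algebra

variable {V : Type*} [AddCommGroup V]

instance : Zero (Complexification V) := ⟨⟨0, 0⟩⟩
instance : Add (Complexification V) := ⟨fun z w => ⟨z.re + w.re, z.im + w.im⟩⟩
instance : Neg (Complexification V) := ⟨fun z => ⟨-z.re, -z.im⟩⟩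

@[simp] theorem zero_re : (0 : Complexification V).re = 0 := rfl
@[simp] theorem zero_im : (0 : Complexification V).im = 0 := rfl
@[simp] theorem add_re (z w : Complexification V) : (z + w).re = z.re + w.re := rfl
@[simp] theorem add_im (z w : Complexification V) : (z + w).im = z.im + w.im := rfl
@[simp] theorem neg_re (z : Complexification V) : (-z).re = -z.re := rfl
@[simp] theorem neg_im (z : Complexification V) : (-z).im = -z.im := rfl

instance : AddCommGroup (Complexification V) where
  add_assoc a b c := by ext <;> simp [add_assoc]
  zero_add a := by ext <;> simp
  add_zero a := by ext <;> simp
  add_comm a b := by ext <;> simp [add_comm]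
  neg_add_cancel a := by ext <;> simp
  nsmul := nsmulRec
  zsmul := zsmulRec

variable [Module ℝ V]

/-- `(a + ib)(x + iy) = (ax - by) + i(ay + bx)`. -/
instance : SMul ℂ (Complexification V) :=
  ⟨fun c z => ⟨c.re • z.re - c.im • z.im, c.re • z.im + c.im • z.re⟩⟩

@[simp] theorem smul_re (c : ℂ) (z : Complexification V) :
    (c • z).re = c.re • z.re - c.im • z.im := rfl
@[simp] theorem smul_im (c : ℂ) (z : Complexification V) :
    (c • z).im = c.re • z.im + c.im • z.re := rfl

instance : Module ℂ (Complexification V) where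
  one_smul z := by ext <;> simp
  mul_smul a b z := by ext <;> simp <;> module
  smul_zero a := by ext <;> simp
  smul_add a z w := by ext <;> simp <;> module
  add_smul a b z := by ext <;> simp <;> module
  zero_smul z := by ext <;> simp

end Algebra

section Norm

variable {V : Type*} [NormedAddCommGroup V] [NormedSpace ℝ V]

/-- The bounded real-linear map `ℂ → V`, `c ↦ Re (c (x + iy)) = (Re c) x - (Im c) y`. -/
noncomputable def rePairing (z : Complexification V) : ℂ →L[ℝ] V :=
  Complex.reCLM.smulRight z.re - Complex.imCLM.smulRight z.im

@[simp] theorem rePairing_apply (z : Complexification V) (c : ℂ) :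
    rePairing z c = c.re • z.re - c.im • z.im := rfl

/-- `rePairing` as an injective additive map. -/
noncomputable def rePairingHom (V : Type*) [NormedAddCommGroup V] [NormedSpace ℝ V] :
    Complexification V →+ (ℂ →L[ℝ] V) where
  toFun := rePairing
  map_zero' := by ext c; simp
  map_add' z w := by ext c; simp; module

theorem rePairingHom_injective : Function.Injective (rePairingHom V) := by
  intro z w h
  have h' : ∀ c : ℂ, rePairing z c = rePairing w c := fun c => DFunLike.congr_fun h c
  ext
  · simpa using h' 1
  · simpa using h' Complex.I

/-- The (Taylor) norm `‖x + iy‖ = sup_{|c| ≤ 1} ‖Re (c (x + iy))‖ = sup_θ ‖cos θ x - sin θ y‖`.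
It is a complex norm, equivalent to `‖x‖ + ‖y‖` and equal to `‖x‖` on `V`. -/
noncomputable instance : NormedAddCommGroup (Complexification V) :=
  NormedAddCommGroup.induced _ _ (rePairingHom V) rePairingHom_injective

theorem norm_def (z : Complexification V) : ‖z‖ = ‖rePairing z‖ := rfl

theorem norm_rePairing_apply_le (z : Complexification V) (c : ℂ) :
    ‖c.re • z.re - c.im • z.im‖ ≤ ‖z‖ * ‖c‖ :=
  (rePairing z).le_opNorm c

theorem norm_le_of_forall {z : Complexification V} {M : ℝ} (hM : 0 ≤ M)
    (h : ∀ c : ℂ, ‖c.re • z.re - c.im • z.im‖ ≤ M * ‖c‖) : ‖z‖ ≤ M :=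
  (rePairing z).opNorm_le_bound hM h

noncomputable instance : NormedSpace ℂ (Complexification V) where
  norm_smul_le d z := norm_le_of_forall (by positivity) fun c => by
    have h := norm_rePairing_apply_le z (c * d)
    rw [norm_mul] at h
    calc _ = ‖(c * d).re • z.re - (c * d).im • z.im‖ := by
            congr 1; simp only [Complex.mul_re, Complex.mul_im, smul_re, smul_im]; module
      _ ≤ _ := h
      _ = _ := by ring

/-- The subset `V = {x + i0 : x ∈ V}` of `V_ℂ`. -/
def realSubspace (V : Type*) [Zero V] : Set (Complexification V) :=
  Set.range fun x : V => ⟨x, 0⟩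

/-- The conjugation `C : V_ℂ → V_ℂ`, `x + iy ↦ x - iy`, a continuous conjugate-linear map. -/
noncomputable def conj (V : Type*) [NormedAddCommGroup V] [NormedSpace ℝ V] :
    Complexification V →SL[starRingEnd ℂ] Complexification V :=
  LinearMap.mkContinuous
    { toFun := fun z => ⟨z.re, -z.im⟩
      map_add' := fun z w => by ext <;> simp [add_comm]
      map_smul' := fun c z => by ext <;> simp <;> module } 1
    fun z => norm_le_of_forall (by positivity) fun c => by
      simpa using norm_rePairing_apply_le z ((starRingEnd ℂ) c)

/-- `S^♭ = C S C`. -/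
noncomputable def flat (S : Complexification V →L[ℂ] Complexification V) :
    Complexification V →L[ℂ] Complexification V :=
  ((conj V).comp S).comp (conj V)

/-- The extension `T_ℂ (x + iy) = T x + i T y` of a real operator `T`. -/
noncomputable def extend (T : V →L[ℝ] V) : Complexification V →L[ℂ] Complexification V :=
  LinearMap.mkContinuous
    { toFun := fun z => ⟨T z.re, T z.im⟩
      map_add' := fun z w => by ext <;> simp
      map_smul' := fun c z => by ext <;> simp } ‖T‖
    fun z => norm_le_of_forall (by positivity) fun c => by
      calc _ = ‖T (c.re • z.re - c.im • z.im)‖ := by simp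
        _ ≤ ‖T‖ * (‖z‖ * ‖c‖) := T.le_opNorm_of_le (norm_rePairing_apply_le z c)
        _ = _ := by ring

end Norm

end Complexification

/-- The complex spectrum of an element `a` of a real algebra:
`σ_ℂ(a) = {u + iv : (u - a)² + v² is not invertible}`. -/
def complexSpectrum {A : Type*} [Ring A] [Algebra ℝ A] (a : A) : Set ℂ :=
  {z | ¬ IsUnit ((algebraMap ℝ A z.re - a) ^ 2 + algebraMap ℝ A (z.im ^ 2))}

/-! ### Cauchy domains and contour integrals -/

/-- A path in `ℂ`, parametrized by `[0, 1]`, is piecewise smooth: `[0, 1]` splits into finitely many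
closed intervals on each of which the path is continuously differentiable (one-sided derivatives
at the endpoints of each interval). -/
def IsPiecewiseSmooth {a b : ℂ} (γ : Path a b) : Prop :=
  ∃ (n : ℕ) (t : ℕ → ℝ), Monotone t ∧ t 0 = 0 ∧ t n = 1 ∧
    ∀ k < n, ContDiffOn ℝ 1 γ.extend (Set.Icc (t k) (t (k + 1)))

/-- A finite family of piecewise smooth closed curves in `ℂ`. -/
structure Contour where
  /-- The number of curves. -/
  num : ℕ
  /-- The base points of the curves. -/
  base : Fin num → ℂ
  /-- The curves. -/
  curve : ∀ j, Path (base j) (base j)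
  piecewiseSmooth : ∀ j, IsPiecewiseSmooth (curve j)

namespace Contour

/-- The set of points of the curves of `Γ`. -/
def support (Γ : Contour) : Set ℂ := ⋃ j, Set.range (Γ.curve j)

/-- `∫_Γ f(ζ) dζ`: the sum over the curves `γ` of `Γ` of `∫₀¹ γ'(t) f(γ(t)) dt`. -/
noncomputable def integral {E : Type*} [NormedAddCommGroup E] [NormedSpace ℂ E] (Γ : Contour)
    (f : ℂ → E) : E :=
  ∑ j, curveIntegral (fun ζ => ContinuousLinearMap.toSpanSingleton ℂ (f ζ)) (Γ.curve j)

/-- The winding number `(2πi)⁻¹ ∫_Γ dζ / (ζ - w)`. -/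
noncomputable def index (Γ : Contour) (w : ℂ) : ℂ :=
  (2 * Real.pi * Complex.I)⁻¹ * Γ.integral fun ζ => (ζ - w)⁻¹

/-- `Δ` is a Cauchy domain in `U` whose boundary is the family of closed curves `Γ`, positively
oriented: `Γ` winds once around each point of `Δ` and does not wind around the points outside the
closure of `Δ`. -/
structure IsBoundaryOfCauchyDomain (Γ : Contour) (U Δ : Set ℂ) : Prop where
  isOpen : IsOpen Δ
  closure_subset : closure Δ ⊆ U
  frontier_eq : frontier Δ = Γ.support
  index_inside : ∀ w ∈ Δ, Γ.index w = 1
  index_outside : ∀ w ∉ closure Δ, Γ.index w = 0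

/-- The Riesz-Dunford integral `(2πi)⁻¹ ∫_Γ F(ζ) (ζ - S)⁻¹ dζ`. -/
noncomputable def rieszDunford {W : Type*} [NormedAddCommGroup W] [NormedSpace ℂ W] (Γ : Contour)
    (F : ℂ → W →L[ℂ] W) (S : W →L[ℂ] W) : W →L[ℂ] W :=
  (2 * Real.pi * Complex.I)⁻¹ • Γ.integral fun ζ => F ζ * resolvent S ζ

end Contour

/-! Put S = T_ℂ. The integrand F(ζ)(ζ - S)⁻¹ is holomorphic on the open set U \ σ(S). Two contours
in this set give the same integral once their winding numbers agree at every point outside it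
(`Contour.integral_eq_of_index_eq`). For a Cauchy domain in U containing σ(S) these numbers are
prescribed: 1 on σ(S) and 0 off U. Hence the integral does not depend on the domain.

The same principle gives the symmetry. As S^♭ = S, both U and σ(S) are invariant under conjugation,
so the mirror image of Γ, traversed backwards, has the same winding numbers off U \ σ(S), and
therefore the same integral. Since (·)^♭ is continuous, conjugate-linear and multiplicative and
sends the integrand at ζ to the integrand at the conjugate of ζ, the mirrored integral is minus the
♭ of the original one. This sign cancels against the conjugate of (2πi)⁻¹, so F(S)^♭ = F(S). An
operator commuting with C preserves the fixed points of C, which form V.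

Cauchy domains come from a fine grid: the squares that meet a compact K ⊂ U form a region inside U
with K in its interior. Sides shared by two of its squares cancel, so Cauchy's theorem, winding
numbers and Cauchy's integral formula reduce to single squares. The homological theorem follows by
inserting the integral formula over such a grid boundary into ∫_Γ f and exchanging the integrals.
Finally σ(T_ℂ) ⊂ σ_ℂ(T) ⊂ U because (u - T)² + v² extends to a product with the factor u + iv - T_ℂ.
-/

open Set MeasureTheory Filter Topology
open scoped unitInterval Interval

/-! ### Integrals along piecewise smooth paths -/

/-- The integral `∫_γ f(ζ) dζ` of a vector-valued function along a path in `ℂ`. -/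
noncomputable def pathIntegral {E : Type*} [NormedAddCommGroup E] [NormedSpace ℂ E] {a b : ℂ}
    (γ : Path a b) (f : ℂ → E) : E :=
  curveIntegral (fun ζ => ContinuousLinearMap.toSpanSingleton ℂ (f ζ)) γ

section PiecewiseSmooth

variable {a b c : ℂ} {γ : Path a b}

theorem IsPiecewiseSmooth.segment (a b : ℂ) : IsPiecewiseSmooth (Path.segment a b) := by
  refine ⟨1, fun k => k, fun i j h => by simpa using h, by simp, by simp, fun k hk => ?_⟩
  obtain rfl : k = 0 := by omega
  have h : ContDiff ℝ 1 (AffineMap.lineMap a b : ℝ → ℂ) := by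
    rw [AffineMap.coe_lineMap]
    simp only [vsub_eq_sub, vadd_eq_add]
    fun_prop
  simpa using h.contDiffOn.congr (Path.eqOn_extend_segment a b)

theorem IsPiecewiseSmooth.cast {a' b' : ℂ} (h : IsPiecewiseSmooth γ) (ha : a' = a) (hb : b' = b) :
    IsPiecewiseSmooth (γ.cast ha hb) := by
  subst ha hb; exact h

theorem IsPiecewiseSmooth.symm (h : IsPiecewiseSmooth γ) : IsPiecewiseSmooth γ.symm := by
  obtain ⟨n, t, ht, h0, h1, hs⟩ := h
  refine ⟨n, fun k => 1 - t (n - k), fun i j hij => ?_, by simp [h1], by simp [h0], fun k hk => ?_⟩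
  · have := ht (show n - j ≤ n - i by omega)
    simp only; linarith
  · have h2 := hs (n - (k + 1)) (by omega)
    rw [show n - (k + 1) + 1 = n - k by omega] at h2
    rw [Path.extend_symm]
    refine h2.comp (contDiffOn_const.sub contDiffOn_id) fun x hx => ?_
    simp only [mem_Icc] at hx ⊢
    constructor <;> linarith [hx.1, hx.2]

theorem IsPiecewiseSmooth.trans {γ' : Path b c} (h : IsPiecewiseSmooth γ)
    (h' : IsPiecewiseSmooth γ') : IsPiecewiseSmooth (γ.trans γ') := by
  obtain ⟨n, t, ht, h0, h1, hs⟩ := h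
  obtain ⟨n', t', ht', h0', h1', hs'⟩ := h'
  refine ⟨n + n', fun k => if k ≤ n then t k / 2 else (1 + t' (k - n)) / 2, fun i j hij => ?_,
    by simp [h0], ?_, fun k hk => ?_⟩
  · have hn : ∀ m ≤ n, t m ≤ 1 := fun m hm => h1 ▸ ht hm
    have hn' : ∀ m, 0 ≤ t' m := fun m => h0' ▸ ht' (Nat.zero_le m)
    dsimp only
    split_ifs with hi hj
    · linarith [ht hij]
    · linarith [hn i hi, hn' (j - n)]
    · omega
    · linarith [ht' (show i - n ≤ j - n by omega)]
  -- A subdivision without intervals would give `t' 0 = 0` and `t' 0 = 1` at once. Excluding it puts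
  -- the last index in the second branch.
  · by_cases hn : n' = 0
    · subst hn; linarith
    · dsimp only
      rw [if_neg (by omega), Nat.add_sub_cancel_left, h1']; norm_num
  · dsimp only
    by_cases hkn : k < n
    · rw [if_pos (by omega), if_pos (by omega)]
      have h2 : ContDiffOn ℝ 1 (fun x => γ.extend (2 * x)) (Icc (t k / 2) (t (k + 1) / 2)) := by
        refine (hs k hkn).comp (contDiffOn_const.mul contDiffOn_id) fun x hx => ?_
        simp only [mem_Icc] at hx ⊢
        constructor <;> linarith [hx.1, hx.2]
      refine h2.congr fun x hx => Path.extend_trans_of_le_half _ _ ?_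
      have : t (k + 1) ≤ 1 := h1 ▸ ht (show k + 1 ≤ n by omega)
      linarith [hx.2]
    -- At the junction `k = n` both formulas give the breakpoint 1/2.
    · have e1 : (if k ≤ n then t k / 2 else (1 + t' (k - n)) / 2) = (1 + t' (k - n)) / 2 := by
        split_ifs with hk'
        · obtain rfl : k = n := by omega
          simp [h0', h1]
        · rfl
      rw [e1, if_neg (by omega)]
      have h2 : ContDiffOn ℝ 1 (fun x => γ'.extend (2 * x - 1))
          (Icc ((1 + t' (k - n)) / 2) ((1 + t' (k + 1 - n)) / 2)) := by
        refine (hs' (k - n) (by omega)).comp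
          ((contDiffOn_const.mul contDiffOn_id).sub contDiffOn_const) fun x hx => ?_
        rw [show k + 1 - n = k - n + 1 by omega] at hx
        simp only [mem_Icc] at hx ⊢
        constructor <;> linarith [hx.1, hx.2]
      refine h2.congr fun x hx => Path.extend_trans_of_half_le _ _ ?_
      have : 0 ≤ t' (k - n) := h0' ▸ ht' (Nat.zero_le _)
      linarith [hx.1]

theorem IsPiecewiseSmooth.map (h : IsPiecewiseSmooth γ) (L : ℂ →L[ℝ] ℂ) :
    IsPiecewiseSmooth (γ.map L.continuous) := by
  obtain ⟨n, t, ht, h0, h1, hs⟩ := h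
  exact ⟨n, t, ht, h0, h1, fun k hk => L.contDiff.comp_contDiffOn (hs k hk)⟩

theorem IsPiecewiseSmooth.exists_finite_differentiableAt (h : IsPiecewiseSmooth γ) :
    ∃ s : Set ℝ, s.Finite ∧ ∀ x ∈ Ioo (0 : ℝ) 1 \ s, DifferentiableAt ℝ γ.extend x := by
  obtain ⟨n, t, ht, h0, h1, hs⟩ := h
  refine ⟨t '' Iic n, (finite_Iic n).image t, fun x hx => ?_⟩
  have hex : ∃ m, x ≤ t m := ⟨n, h1 ▸ hx.1.2.le⟩
  classical
  have hm := Nat.find_spec hex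
  have hmn : Nat.find hex ≤ n := Nat.find_min' hex (h1 ▸ hx.1.2.le)
  have hm0 : Nat.find hex ≠ 0 := fun h => by
    rw [h, h0] at hm; exact absurd hx.1.1 (not_lt.2 hm)
  obtain ⟨k, hk⟩ := Nat.exists_eq_succ_of_ne_zero hm0
  have hlt : t k < x := not_le.1 (Nat.find_min hex (by omega))
  rw [hk] at hm hmn
  have hne : x ≠ t (k + 1) := fun h => hx.2 ⟨k + 1, hmn, h.symm⟩
  exact ((hs k (by omega)).differentiableOn one_ne_zero).differentiableAt
    (Icc_mem_nhds hlt (lt_of_le_of_ne hm hne))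

/-- On each piece the two-sided derivative agrees, off the two endpoints, with the one-sided one,
which is continuous up to the endpoints. -/
theorem IsPiecewiseSmooth.intervalIntegrable_deriv (h : IsPiecewiseSmooth γ) :
    IntervalIntegrable (deriv γ.extend) volume 0 1 := by
  obtain ⟨n, t, ht, h0, h1, hs⟩ := h
  rw [← h0, ← h1]
  refine IntervalIntegrable.trans_iterate fun k hk => ?_
  rcases (ht (Nat.le_succ k)).eq_or_lt with heq | hlt
  · rw [heq]
  · have h2 : IntervalIntegrable (derivWithin γ.extend (Icc (t k) (t (k + 1)))) volume (t k)
        (t (k + 1)) :=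
      ((hs k hk).continuousOn_derivWithin (uniqueDiffOn_Icc hlt) le_rfl).intervalIntegrable_of_Icc
        hlt.le
    refine h2.congr_ae ?_
    rw [uIoc_of_le hlt.le, ← restrict_Ioo_eq_restrict_Ioc]
    filter_upwards [ae_restrict_mem measurableSet_Ioo] with x hx
    exact derivWithin_of_mem_nhds (Icc_mem_nhds hx.1 hx.2)

end PiecewiseSmooth

theorem continuous_comp_extend {E : Type*} [TopologicalSpace E] {a b : ℂ} {γ : Path a b}
    {f : ℂ → E} (hf : ContinuousOn f (range γ)) : Continuous fun t => f (γ.extend t) :=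
  hf.comp_continuous γ.continuous_extend fun t => by
    rw [← γ.extend_range]; exact mem_range_self t

section Integral

variable {E : Type*} [NormedAddCommGroup E] [NormedSpace ℂ E] {a b c : ℂ} {γ : Path a b}
  {f g : ℂ → E}

theorem pathIntegral_eq (γ : Path a b) (f : ℂ → E) :
    pathIntegral γ f = ∫ t in (0 : ℝ)..1, deriv γ.extend t • f (γ.extend t) := by
  simp [pathIntegral, curveIntegral_eq_intervalIntegral_deriv]

theorem IsPiecewiseSmooth.intervalIntegrable (h : IsPiecewiseSmooth γ)
    (hf : ContinuousOn f (range γ)) :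
    IntervalIntegrable (fun t => deriv γ.extend t • f (γ.extend t)) volume 0 1 :=
  h.intervalIntegrable_deriv.smul_continuousOn (continuous_comp_extend hf).continuousOn

theorem IsPiecewiseSmooth.curveIntegrable (h : IsPiecewiseSmooth γ)
    (hf : ContinuousOn f (range γ)) :
    CurveIntegrable (fun ζ => ContinuousLinearMap.toSpanSingleton ℂ (f ζ)) γ := by
  refine (h.intervalIntegrable hf).congr_ae ?_
  rw [uIoc_of_le zero_le_one, ← restrict_Ioo_eq_restrict_Ioc]
  filter_upwards [ae_restrict_mem measurableSet_Ioo] with x hx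
  rw [curveIntegralFun_def, derivWithin_of_mem_nhds (Icc_mem_nhds hx.1 hx.2)]
  simp

theorem pathIntegral_symm (γ : Path a b) (f : ℂ → E) :
    pathIntegral γ.symm f = -pathIntegral γ f :=
  curveIntegral_symm _ _

theorem pathIntegral_trans {γ' : Path b c} (h : IsPiecewiseSmooth γ) (h' : IsPiecewiseSmooth γ')
    (hf : ContinuousOn f (range γ)) (hf' : ContinuousOn f (range γ')) :
    pathIntegral (γ.trans γ') f = pathIntegral γ f + pathIntegral γ' f :=
  curveIntegral_trans (h.curveIntegrable hf) (h'.curveIntegrable hf')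

theorem pathIntegral_congr (h : ∀ ζ ∈ range γ, f ζ = g ζ) :
    pathIntegral γ f = pathIntegral γ g := by
  simp only [pathIntegral_eq]
  have : ∀ t, γ.extend t ∈ range γ := fun t => by rw [← γ.extend_range]; exact mem_range_self t
  exact intervalIntegral.integral_congr fun t _ => by simp only [h _ (this t)]

theorem pathIntegral_sub (h : IsPiecewiseSmooth γ) (hf : ContinuousOn f (range γ))
    (hg : ContinuousOn g (range γ)) :
    pathIntegral γ (fun ζ => f ζ - g ζ) = pathIntegral γ f - pathIntegral γ g := by
  simp only [pathIntegral_eq, smul_sub]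
  exact intervalIntegral.integral_sub (h.intervalIntegrable hf) (h.intervalIntegrable hg)

theorem pathIntegral_smul (γ : Path a b) (c : ℂ) (f : ℂ → E) :
    pathIntegral γ (fun ζ => c • f ζ) = c • pathIntegral γ f := by
  simp only [pathIntegral_eq, smul_comm _ c, intervalIntegral.integral_smul]

theorem pathIntegral_smul_const (γ : Path a b) (f : ℂ → ℂ) [CompleteSpace E] (x : E) :
    pathIntegral γ (fun ζ => f ζ • x) = pathIntegral γ f • x := by
  simp only [pathIntegral_eq, smul_smul, intervalIntegral.integral_smul_const, smul_eq_mul]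

/-- The fundamental theorem of calculus for a primitive in a set containing the path. -/
theorem pathIntegral_of_hasDerivWithinAt [CompleteSpace E] (h : IsPiecewiseSmooth γ) {s : Set ℂ}
    (hs : range γ ⊆ s) (hf : ContinuousOn f (range γ))
    (hg : ∀ z ∈ s, HasDerivWithinAt g (f z) s z) : pathIntegral γ f = g b - g a := by
  obtain ⟨e, he, hd⟩ := h.exists_finite_differentiableAt
  have hmem : ∀ t, γ.extend t ∈ s := fun t => hs <| by
    rw [← γ.extend_range]; exact mem_range_self t
  have hc : ContinuousOn g s := fun z hz => (hg z hz).continuousWithinAt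
  rw [pathIntegral_eq, integral_eq_of_hasDerivAt_off_countable_of_le (fun t => g (γ.extend t)) _
    zero_le_one he.countable (hc.comp γ.continuous_extend.continuousOn fun t _ => hmem t) ?_
    (h.intervalIntegrable hf)]
  · simp
  · intro t ht
    exact (hg _ (hmem t)).scomp_hasDerivAt t (hd t ht).hasDerivAt hmem

/-- Fubini applies: the kernel is bounded on the compact product of the ranges, and the product of
the two derivatives is integrable on the unit square. -/
theorem pathIntegral_swap {a' b' : ℂ} {η : Path a' b'} (hγ : IsPiecewiseSmooth γ)
    (hη : IsPiecewiseSmooth η) {k : ℂ → ℂ → E}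
    (hk : ContinuousOn (Function.uncurry k) (range γ ×ˢ range η)) :
    pathIntegral γ (fun z => pathIntegral η (k z)) =
      pathIntegral η (fun w => pathIntegral γ (fun z => k z w)) := by
  have hmem : ∀ p : ℝ × ℝ, (γ.extend p.1, η.extend p.2) ∈ range γ ×ˢ range η := fun p => by
    rw [← γ.extend_range, ← η.extend_range]
    exact ⟨mem_range_self _, mem_range_self _⟩
  have hcont : Continuous fun p : ℝ × ℝ => k (γ.extend p.1) (η.extend p.2) :=
    hk.comp_continuous (f := fun p : ℝ × ℝ => (γ.extend p.1, η.extend p.2))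
      (by have := γ.continuous_extend; have := η.continuous_extend; fun_prop) hmem
  obtain ⟨C, hC⟩ := ((isCompact_range γ.continuous).prod
    (isCompact_range η.continuous)).exists_bound_of_continuousOn hk
  have h1 : Integrable (fun p : ℝ × ℝ => (deriv γ.extend p.1 * deriv η.extend p.2) •
      k (γ.extend p.1) (η.extend p.2))
      ((volume.restrict (Ioc (0 : ℝ) 1)).prod (volume.restrict (Ioc (0 : ℝ) 1))) := by
    refine Integrable.smul_bdd ?_ C hcont.aestronglyMeasurable
      (Eventually.of_forall fun p => hC _ (hmem p))
    have h1 := hγ.intervalIntegrable_deriv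
    have h2 := hη.intervalIntegrable_deriv
    rw [intervalIntegrable_iff_integrableOn_Ioc_of_le zero_le_one] at h1 h2
    exact Integrable.mul_prod h1 h2
  simp only [pathIntegral_eq, intervalIntegral.integral_of_le (zero_le_one' ℝ), ← integral_smul,
    smul_smul]
  rw [integral_integral_swap h1]
  simp only [mul_comm]

end Integral

/-! ### Integrals over contours -/

namespace Contour

variable {E : Type*} [NormedAddCommGroup E] [NormedSpace ℂ E] {Γ Γ' : Contour} {f g : ℂ → E}

theorem integral_eq_sum (Γ : Contour) (f : ℂ → E) :
    Γ.integral f = ∑ j, pathIntegral (Γ.curve j) f := rfl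

theorem range_subset_support (Γ : Contour) (j : Fin Γ.num) : range (Γ.curve j) ⊆ Γ.support :=
  subset_iUnion (fun j => range (Γ.curve j)) j

theorem isCompact_support (Γ : Contour) : IsCompact Γ.support :=
  isCompact_iUnion fun j => isCompact_range (Γ.curve j).continuous

theorem integral_congr (h : ∀ ζ ∈ Γ.support, f ζ = g ζ) : Γ.integral f = Γ.integral g :=
  Finset.sum_congr rfl fun j _ => pathIntegral_congr fun ζ hζ => h ζ (Γ.range_subset_support j hζ)

theorem integral_sub (hf : ContinuousOn f Γ.support) (hg : ContinuousOn g Γ.support) :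
    Γ.integral (fun ζ => f ζ - g ζ) = Γ.integral f - Γ.integral g := by
  simp only [integral_eq_sum, ← Finset.sum_sub_distrib]
  exact Finset.sum_congr rfl fun j _ => pathIntegral_sub (Γ.piecewiseSmooth j)
    (hf.mono (Γ.range_subset_support j)) (hg.mono (Γ.range_subset_support j))

theorem integral_smul (Γ : Contour) (c : ℂ) (f : ℂ → E) :
    Γ.integral (fun ζ => c • f ζ) = c • Γ.integral f := by
  simp only [integral_eq_sum, pathIntegral_smul, Finset.smul_sum]

theorem integral_smul_const [CompleteSpace E] (Γ : Contour) (f : ℂ → ℂ) (x : E) :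
    Γ.integral (fun ζ => f ζ • x) = Γ.integral f • x := by
  simp only [integral_eq_sum, pathIntegral_smul_const, Finset.sum_smul]

theorem integral_eq_zero_of_hasDerivWithinAt [CompleteSpace E] {s : Set ℂ} (hs : Γ.support ⊆ s)
    (hf : ContinuousOn f Γ.support) (hg : ∀ z ∈ s, HasDerivWithinAt g (f z) s z) :
    Γ.integral f = 0 :=
  Finset.sum_eq_zero fun j _ => by
    rw [← sub_self (g (Γ.base j))]
    exact pathIntegral_of_hasDerivWithinAt (Γ.piecewiseSmooth j)
      ((Γ.range_subset_support j).trans hs) (hf.mono (Γ.range_subset_support j)) hg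

theorem pathIntegral_sum {a b : ℂ} {γ : Path a b} (hγ : IsPiecewiseSmooth γ) {ι : Type*}
    (s : Finset ι) {F : ι → ℂ → E} (hF : ∀ i ∈ s, ContinuousOn (F i) (range γ)) :
    pathIntegral γ (fun ζ => ∑ i ∈ s, F i ζ) = ∑ i ∈ s, pathIntegral γ (F i) := by
  simp only [pathIntegral_eq, Finset.smul_sum]
  exact intervalIntegral.integral_finsetSum fun i hi => hγ.intervalIntegrable (hF i hi)

/-- Dominated convergence, with bound |γ'| times the supremum of the kernel. The continuity lets
`integral_swap` split an outer integral over the curves of the inner contour. -/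
theorem continuousOn_pathIntegral {a b : ℂ} {γ : Path a b} (hγ : IsPiecewiseSmooth γ) {s : Set ℂ}
    (hs : IsCompact s) {k : ℂ → ℂ → E} (hk : ContinuousOn (Function.uncurry k) (s ×ˢ range γ)) :
    ContinuousOn (fun z => pathIntegral γ (k z)) s := by
  obtain ⟨C, hC⟩ := (hs.prod (isCompact_range γ.continuous)).exists_bound_of_continuousOn hk
  have hmem : ∀ t, γ.extend t ∈ range γ := fun t => by
    rw [← γ.extend_range]; exact mem_range_self t
  simp only [pathIntegral_eq]
  intro z hz
  refine intervalIntegral.continuousWithinAt_of_dominated_interval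
    (bound := fun t => ‖deriv γ.extend t‖ * C) ?_ ?_ ?_ ?_
  · filter_upwards [self_mem_nhdsWithin] with x hx
    have h1 : ContinuousOn (k x) (range γ) :=
      hk.comp (by fun_prop : Continuous fun w => (x, w)).continuousOn fun w hw => ⟨hx, hw⟩
    have h2 := hγ.intervalIntegrable h1
    rw [intervalIntegrable_iff] at h2
    exact h2.aestronglyMeasurable
  · filter_upwards [self_mem_nhdsWithin] with x hx
    refine Eventually.of_forall fun t _ => ?_
    rw [norm_smul]
    exact mul_le_mul_of_nonneg_left (hC (x, γ.extend t) ⟨hx, hmem t⟩) (norm_nonneg _)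
  · exact hγ.intervalIntegrable_deriv.norm.mul_const C
  · refine Eventually.of_forall fun t _ => ?_
    have h1 : ContinuousOn (fun x => k x (γ.extend t)) s :=
      hk.comp (by fun_prop : Continuous fun x => (x, γ.extend t)).continuousOn
        fun x hx => ⟨hx, hmem t⟩
    exact (h1 z hz).const_smul _

theorem integral_swap {k : ℂ → ℂ → E}
    (hk : ContinuousOn (Function.uncurry k) (Γ.support ×ˢ Γ'.support)) :
    Γ.integral (fun z => Γ'.integral (k z)) = Γ'.integral (fun w => Γ.integral (fun z => k z w)) := by
  simp only [integral_eq_sum]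
  have e1 : ∀ j, pathIntegral (Γ.curve j) (fun z => ∑ i, pathIntegral (Γ'.curve i) (k z)) =
      ∑ i, pathIntegral (Γ.curve j) (fun z => pathIntegral (Γ'.curve i) (k z)) := fun j =>
    pathIntegral_sum (Γ.piecewiseSmooth j) _ fun i _ =>
      continuousOn_pathIntegral (Γ'.piecewiseSmooth i) (isCompact_range (Γ.curve j).continuous)
        (hk.mono (prod_mono (Γ.range_subset_support j) (Γ'.range_subset_support i)))
  have e2 : ∀ i, pathIntegral (Γ'.curve i) (fun w => ∑ j, pathIntegral (Γ.curve j) (k · w)) =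
      ∑ j, pathIntegral (Γ'.curve i) (fun w => pathIntegral (Γ.curve j) (k · w)) := fun i =>
    pathIntegral_sum (Γ'.piecewiseSmooth i) _ fun j _ =>
      continuousOn_pathIntegral (Γ.piecewiseSmooth j) (isCompact_range (Γ'.curve i).continuous)
        (k := fun w z => k z w)
        (hk.comp continuous_swap.continuousOn fun p hp =>
          ⟨Γ.range_subset_support j hp.2, Γ'.range_subset_support i hp.1⟩)
  rw [Finset.sum_congr rfl fun j _ => e1 j, Finset.sum_congr rfl fun i _ => e2 i,
    Finset.sum_comm]
  exact Finset.sum_congr rfl fun i _ => Finset.sum_congr rfl fun j _ =>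
    pathIntegral_swap (Γ.piecewiseSmooth j) (Γ'.piecewiseSmooth i)
      (hk.mono (prod_mono (Γ.range_subset_support j) (Γ'.range_subset_support i)))

/-! ### The winding number -/

theorem continuousOn_inv_sub {s : Set ℂ} {w : ℂ} (hw : w ∉ s) :
    ContinuousOn (fun ζ : ℂ => (ζ - w)⁻¹) s :=
  (continuousOn_id.sub continuousOn_const).inv₀ fun ζ hζ h =>
    hw ((sub_eq_zero.1 h : ζ = w) ▸ hζ)

/-- The quotient (ζ - w)/(ζ - w₀) = 1 + (w₀ - w)/(ζ - w₀) stays within distance 1 of 1 on Γ. So its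
principal logarithm is a primitive of the difference of the two integrands. -/
theorem index_eq_of_forall_dist_lt {w w₀ : ℂ} (h : ∀ ζ ∈ Γ.support, dist w w₀ < dist ζ w₀) :
    Γ.index w = Γ.index w₀ := by
  have hw : w ∉ Γ.support := fun hw => lt_irrefl _ (h w hw)
  have hw₀ : w₀ ∉ Γ.support := fun hw => by simpa using dist_nonneg.trans_lt (h w₀ hw)
  rw [index, index, ← sub_eq_zero, ← mul_sub,
    ← integral_sub (continuousOn_inv_sub hw) (continuousOn_inv_sub hw₀)]
  refine mul_eq_zero_of_right _ (integral_eq_zero_of_hasDerivWithinAt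
    (g := fun ζ => Complex.log ((ζ - w) / (ζ - w₀))) subset_rfl
    ((continuousOn_inv_sub hw).sub (continuousOn_inv_sub hw₀)) fun z hz => ?_)
  have h1 : z - w ≠ 0 := sub_ne_zero.2 fun e => hw (e ▸ hz)
  have h2 : z - w₀ ≠ 0 := sub_ne_zero.2 fun e => hw₀ (e ▸ hz)
  have h3 : (z - w) / (z - w₀) ∈ Complex.slitPlane := by
    have : (z - w) / (z - w₀) = 1 + (w₀ - w) / (z - w₀) := by field_simp; ring
    rw [this]
    refine Complex.mem_slitPlane_of_norm_lt_one ?_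
    rw [norm_div, div_lt_one (norm_pos_iff.2 h2), ← dist_eq_norm, ← dist_eq_norm, dist_comm]
    exact h z hz
  have h4 := ((((hasDerivAt_id z).sub_const w).div ((hasDerivAt_id z).sub_const w₀) h2).clog
    h3).hasDerivWithinAt (s := Γ.support)
  refine h4.congr_deriv ?_
  change ((1 * (z - w₀) - (z - w) * 1) / (z - w₀) ^ 2) / ((z - w) / (z - w₀)) = _
  field_simp

theorem eventually_index_eq {w₀ : ℂ} (h : w₀ ∉ Γ.support) : ∀ᶠ w in 𝓝 w₀, Γ.index w = Γ.index w₀ := by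
  obtain ⟨r, hr, hb⟩ := Metric.isOpen_iff.1 Γ.isCompact_support.isClosed.isOpen_compl w₀ h
  filter_upwards [Metric.ball_mem_nhds w₀ hr] with w hw
  refine index_eq_of_forall_dist_lt fun ζ hζ => (Metric.mem_ball.1 hw).trans_le ?_
  by_contra! hlt
  exact hb (Metric.mem_ball.2 hlt) hζ

/-- Here log(1 - ζ/w) is a primitive along Γ, because |ζ/w| < 1. -/
theorem index_eq_zero_of_forall_norm_lt {w : ℂ} (h : ∀ ζ ∈ Γ.support, ‖ζ‖ < ‖w‖) :
    Γ.index w = 0 := by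
  have hw : w ∉ Γ.support := fun hw => lt_irrefl _ (h w hw)
  rw [index]
  refine mul_eq_zero_of_right _ (integral_eq_zero_of_hasDerivWithinAt
    (g := fun ζ => Complex.log (1 - ζ / w)) subset_rfl (continuousOn_inv_sub hw) fun z hz => ?_)
  have h0 : w ≠ 0 := norm_pos_iff.1 ((norm_nonneg z).trans_lt (h z hz))
  have h1 : z - w ≠ 0 := sub_ne_zero.2 fun e => hw (e ▸ hz)
  have h3 : 1 - z / w ∈ Complex.slitPlane := by
    rw [sub_eq_add_neg]
    refine Complex.mem_slitPlane_of_norm_lt_one ?_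
    rw [norm_neg, norm_div, div_lt_one (norm_pos_iff.2 h0)]
    exact h z hz
  have h4 := ((((hasDerivAt_id z).div_const w).const_sub 1).clog h3).hasDerivWithinAt
    (s := Γ.support)
  refine h4.congr_deriv ?_
  have h5 : 1 - z / w = -(z - w) / w := by field_simp; ring
  change -(1 / w) / (1 - z / w) = _
  rw [h5]
  field_simp

end Contour

/-! ### Closed curves from balanced families of segments -/

/-- `x` and `y` are joined by a piecewise smooth path in `B`. -/
def SmoothlyJoined (B : Set ℂ) (x y : ℂ) : Prop :=
  ∃ γ : Path x y, IsPiecewiseSmooth γ ∧ range γ ⊆ B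

namespace SmoothlyJoined

variable {B : Set ℂ} {x y z : ℂ}

theorem symm (h : SmoothlyJoined B x y) : SmoothlyJoined B y x := by
  obtain ⟨γ, hγ, hB⟩ := h
  exact ⟨γ.symm, hγ.symm, by rwa [Path.symm_range]⟩

theorem trans (h : SmoothlyJoined B x y) (h' : SmoothlyJoined B y z) : SmoothlyJoined B x z := by
  obtain ⟨γ, hγ, hB⟩ := h
  obtain ⟨γ', hγ', hB'⟩ := h'
  exact ⟨γ.trans γ', hγ.trans hγ', by rw [Path.trans_range]; exact union_subset hB hB'⟩

theorem of_segment_subset (h : segment ℝ x y ⊆ B) : SmoothlyJoined B x y :=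
  ⟨Path.segment x y, .segment x y, by rwa [Path.range_segment]⟩

end SmoothlyJoined

/-- A point joined to `x` in `B` which is the same for all `x` that are joined to each other. -/
noncomputable def joinedBase (B : Set ℂ) (x : ℂ) : ℂ :=
  Classical.epsilon fun y => SmoothlyJoined B y x

section

variable {B : Set ℂ} {x y : ℂ}

theorem smoothlyJoined_joinedBase (h : SmoothlyJoined B y x) :
    SmoothlyJoined B (joinedBase B x) x :=
  Classical.epsilon_spec (p := fun y => SmoothlyJoined B y x) ⟨y, h⟩

/-- Points joined to each other define the same predicate, and `Classical.epsilon` depends only on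
the predicate. -/
theorem joinedBase_eq (h : SmoothlyJoined B x y) : joinedBase B x = joinedBase B y := by
  unfold joinedBase
  congr 1
  exact funext fun z => propext ⟨fun hz => hz.trans h, fun hz => hz.trans h.symm⟩

/-- A piecewise smooth path in `B` from the base point to `x`. -/
noncomputable def pathFromBase (h : SmoothlyJoined B x x) : Path (joinedBase B x) x :=
  (smoothlyJoined_joinedBase h).choose

theorem pathFromBase_smooth (h : SmoothlyJoined B x x) : IsPiecewiseSmooth (pathFromBase h) :=
  (smoothlyJoined_joinedBase h).choose_spec.1

theorem range_pathFromBase (h : SmoothlyJoined B x x) : range (pathFromBase h) ⊆ B :=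
  (smoothlyJoined_joinedBase h).choose_spec.2

/-- The closed curve that goes from the base point to `x`, along a segment to `y`, and back. -/
noncomputable def segmentLoop (h : SmoothlyJoined B x y) :
    Path (joinedBase B x) (joinedBase B x) :=
  ((pathFromBase (h.trans h.symm)).trans (Path.segment x y)).trans
    ((pathFromBase (h.symm.trans h)).symm.cast rfl (joinedBase_eq h))

theorem segmentLoop_smooth (h : SmoothlyJoined B x y) : IsPiecewiseSmooth (segmentLoop h) :=
  ((pathFromBase_smooth _).trans (.segment x y)).trans ((pathFromBase_smooth _).symm.cast _ _)

theorem range_segmentLoop (h : SmoothlyJoined B x y) :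
    range (segmentLoop h) = range (pathFromBase (h.trans h.symm)) ∪ segment ℝ x y ∪
      range (pathFromBase (h.symm.trans h)) := by
  rw [segmentLoop, Path.trans_range, Path.trans_range, Path.range_segment, Path.cast_coe,
    Path.symm_range]

theorem pathIntegral_segmentLoop {E : Type*} [NormedAddCommGroup E] [NormedSpace ℂ E]
    (h : SmoothlyJoined B x y) (hB : segment ℝ x y ⊆ B) {f : ℂ → E} (hf : ContinuousOn f B) :
    pathIntegral (segmentLoop h) f = pathIntegral (pathFromBase (h.trans h.symm)) f +
      pathIntegral (Path.segment x y) f - pathIntegral (pathFromBase (h.symm.trans h)) f := by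
  have hf1 := hf.mono (range_pathFromBase (h.trans h.symm))
  have hf2 : ContinuousOn f (range (Path.segment x y)) := hf.mono (by rwa [Path.range_segment])
  have hf3 := hf.mono (range_pathFromBase (h.symm.trans h))
  rw [segmentLoop, pathIntegral_trans ((pathFromBase_smooth _).trans (.segment x y))
    ((pathFromBase_smooth _).symm.cast _ _), pathIntegral_trans (pathFromBase_smooth _)
    (.segment x y) hf1 hf2, sub_eq_add_neg, ← pathIntegral_symm]
  · congr 1
    exact curveIntegral_cast _ _ _ _
  · rw [Path.trans_range]
    exact (hf.mono (union_subset (range_pathFromBase _) (by rwa [Path.range_segment])))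
  · rwa [Path.cast_coe, Path.symm_range]

end

section

variable {n : ℕ} {a b : Fin n → ℂ}

theorem smoothlyJoined_iUnion_segment (a b : Fin n → ℂ) (i : Fin n) :
    SmoothlyJoined (⋃ j, segment ℝ (a j) (b j)) (a i) (b i) :=
  .of_segment_subset (subset_iUnion (fun j => segment ℝ (a j) (b j)) i)

/-- A contour made of closed curves through the segments from `a i` to `b i`. -/
noncomputable def segmentContour (a b : Fin n → ℂ) : Contour where
  num := n
  base i := joinedBase (⋃ j, segment ℝ (a j) (b j)) (a i)
  curve i := segmentLoop (smoothlyJoined_iUnion_segment a b i)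
  piecewiseSmooth _ := segmentLoop_smooth _

theorem support_segmentContour (a b : Fin n → ℂ) :
    (segmentContour a b).support = ⋃ j, segment ℝ (a j) (b j) := by
  refine subset_antisymm (iUnion_subset fun i => ?_) (iUnion_mono fun i => ?_)
  · change range (segmentLoop (smoothlyJoined_iUnion_segment a b i)) ⊆ _
    rw [range_segmentLoop]
    exact union_subset (union_subset (range_pathFromBase _)
      (subset_iUnion (fun j => segment ℝ (a j) (b j)) i)) (range_pathFromBase _)
  · change _ ⊆ range (segmentLoop (smoothlyJoined_iUnion_segment a b i))
    rw [range_segmentLoop]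
    exact subset_union_right.trans subset_union_left

/-- Closing every segment separately avoids splitting the family into cycles. The connecting paths
contribute h(a i) - h(b i), where h(x) is the integral along the chosen path to x. The balance
hypothesis, that starting points and end points have equal sums under every function, makes these
terms cancel. -/
theorem integral_segmentContour {E : Type*} [NormedAddCommGroup E] [NormedSpace ℂ E]
    (hab : ∀ h : ℂ → E, ∑ i, h (a i) = ∑ i, h (b i)) {f : ℂ → E}
    (hf : ContinuousOn f (⋃ j, segment ℝ (a j) (b j))) :
    (segmentContour a b).integral f = ∑ i, pathIntegral (Path.segment (a i) (b i)) f := by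
  classical
  let h : ℂ → E := fun x =>
    if hx : SmoothlyJoined (⋃ j, segment ℝ (a j) (b j)) x x then pathIntegral (pathFromBase hx) f else 0
  have key : ∀ i, pathIntegral (segmentLoop (smoothlyJoined_iUnion_segment a b i)) f =
      h (a i) + pathIntegral (Path.segment (a i) (b i)) f - h (b i) := fun i => by
    have h1 := smoothlyJoined_iUnion_segment a b i
    rw [pathIntegral_segmentLoop _ (subset_iUnion (fun j => segment ℝ (a j) (b j)) i) hf]
    simp only [h, dif_pos (h1.trans h1.symm), dif_pos (h1.symm.trans h1)]
  calc _ = ∑ i, pathIntegral (segmentLoop (smoothlyJoined_iUnion_segment a b i)) f := rfl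
    _ = _ := by
      rw [Finset.sum_congr rfl fun i _ => key i, Finset.sum_sub_distrib, Finset.sum_add_distrib,
        hab h]
      abel

end

/-! ### Grids of squares -/

namespace Grid

/-- The closed square `[mδ, (m+1)δ] × [nδ, (n+1)δ]` with `p = (m, n)`. -/
def cell (δ : ℝ) (p : ℤ × ℤ) : Set ℂ :=
  Icc (p.1 * δ) ((p.1 + 1) * δ) ×ℂ Icc (p.2 * δ) ((p.2 + 1) * δ)

/-- The interior of `cell δ p`. -/
def openCell (δ : ℝ) (p : ℤ × ℤ) : Set ℂ :=
  Ioo (p.1 * δ) ((p.1 + 1) * δ) ×ℂ Ioo (p.2 * δ) ((p.2 + 1) * δ)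

/-- The vertex `mδ + inδ` with `p = (m, n)`. -/
def vertex (δ : ℝ) (p : ℤ × ℤ) : ℂ := ⟨p.1 * δ, p.2 * δ⟩

/-- The corners of a square in counterclockwise order. -/
def corner : Fin 4 → ℤ × ℤ := ![(0, 0), (1, 0), (1, 1), (0, 1)]

/-- The neighbour of a square across its side from `corner d` to `corner (d + 1)`. -/
def neighbor : Fin 4 → ℤ × ℤ := ![(0, -1), (1, 0), (0, 1), (-1, 0)]

variable {δ : ℝ} {p q : ℤ × ℤ} {d : Fin 4} {z w : ℂ}

theorem neighbor_add_two (d : Fin 4) : neighbor (d + 2) = -neighbor d := by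
  revert d; decide

theorem neighbor_add_corner (d : Fin 4) : neighbor d + corner (d + 2) = corner (d + 1) := by
  revert d; decide

theorem add_two_add_two (d : Fin 4) : d + 2 + 2 = d := by
  revert d; decide

theorem mem_cell : z ∈ cell δ p ↔ (p.1 * δ ≤ z.re ∧ z.re ≤ (p.1 + 1) * δ) ∧
    (p.2 * δ ≤ z.im ∧ z.im ≤ (p.2 + 1) * δ) := Iff.rfl

theorem mem_openCell : z ∈ openCell δ p ↔ (p.1 * δ < z.re ∧ z.re < (p.1 + 1) * δ) ∧
    (p.2 * δ < z.im ∧ z.im < (p.2 + 1) * δ) := Iff.rfl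

theorem isClosed_cell (δ : ℝ) (p : ℤ × ℤ) : IsClosed (cell δ p) :=
  isClosed_Icc.reProdIm isClosed_Icc

theorem isOpen_openCell (δ : ℝ) (p : ℤ × ℤ) : IsOpen (openCell δ p) :=
  isOpen_Ioo.reProdIm isOpen_Ioo

theorem convex_cell (δ : ℝ) (p : ℤ × ℤ) : Convex ℝ (cell δ p) :=
  ((convex_Icc _ _).linear_preimage Complex.reLm).inter
    ((convex_Icc _ _).linear_preimage Complex.imLm)

theorem closure_openCell (hδ : 0 < δ) (p : ℤ × ℤ) : closure (openCell δ p) = cell δ p := by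
  have h : ∀ m : ℤ, (m : ℝ) * δ ≠ (m + 1) * δ := fun m => by nlinarith
  rw [openCell, Complex.closure_reProdIm, closure_Ioo (h _), closure_Ioo (h _), cell]

theorem eq_of_mem_openCell (hδ : 0 < δ) (hz : z ∈ openCell δ p) (hq : z ∈ cell δ q) : q = p := by
  have key : ∀ {m n : ℤ} {x : ℝ}, m * δ < x → x < (m + 1) * δ → n * δ ≤ x → x ≤ (n + 1) * δ →
      n = m := fun {m n x} h1 h2 h3 h4 => by
    have h5 : (m : ℝ) < n + 1 := lt_of_mul_lt_mul_right (h1.trans_le h4) hδ.le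
    have h6 : (n : ℝ) < m + 1 := lt_of_mul_lt_mul_right (h3.trans_lt h2) hδ.le
    norm_cast at h5 h6
    omega
  exact Prod.ext (key hz.1.1 hz.1.2 hq.1.1 hq.1.2) (key hz.2.1 hz.2.2 hq.2.1 hq.2.2)

theorem exists_mem_cell (hδ : 0 < δ) (z : ℂ) : ∃ p, z ∈ cell δ p := by
  have key : ∀ x : ℝ, ⌊x / δ⌋ * δ ≤ x ∧ x ≤ (⌊x / δ⌋ + 1) * δ := fun x =>
    ⟨(le_div_iff₀ hδ).1 (Int.floor_le _), ((div_lt_iff₀ hδ).1 (Int.lt_floor_add_one _)).le⟩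
  exact ⟨(⌊z.re / δ⌋, ⌊z.im / δ⌋), key _, key _⟩

theorem dist_le_of_mem_cell (hz : z ∈ cell δ p) (hw : w ∈ cell δ p) : dist z w ≤ 2 * δ := by
  rw [mem_cell] at hz hw
  rw [dist_eq_norm]
  refine (Complex.norm_le_abs_re_add_abs_im _).trans ?_
  have h1 : |(z - w).re| ≤ δ := by
    rw [Complex.sub_re, abs_le]; constructor <;> nlinarith
  have h2 : |(z - w).im| ≤ δ := by
    rw [Complex.sub_im, abs_le]; constructor <;> nlinarith
  linarith

/-- The grid is locally finite and its squares are closed, so a point near z meets only squares that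
contain z. -/
theorem eventually_mem_cell (hδ : 0 < δ) (z : ℂ) :
    ∀ᶠ w in 𝓝 z, ∀ p, w ∈ cell δ p → z ∈ cell δ p := by
  have key : ∀ x : ℝ, ∀ᶠ y in 𝓝 x, ∀ m : ℤ, y ∈ Icc (m * δ) ((m + 1) * δ) →
      x ∈ Icc (m * δ) ((m + 1) * δ) := fun x => by
    -- The open interval from (⌈x/δ⌉ - 1)δ to (⌊x/δ⌋ + 1)δ contains no multiple of δ except possibly
    -- x itself.
    have h1 : (⌈x / δ⌉ - 1) * δ < x :=
      (lt_div_iff₀ hδ).1 (by linarith [Int.ceil_lt_add_one (x / δ)])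
    have h2 : x < (⌊x / δ⌋ + 1) * δ := (div_lt_iff₀ hδ).1 (Int.lt_floor_add_one _)
    filter_upwards [Ioo_mem_nhds h1 h2] with y hy m hm
    have h3 : (m : ℝ) < ⌊x / δ⌋ + 1 := lt_of_mul_lt_mul_right (hm.1.trans_lt hy.2) hδ.le
    have h4 : ((⌈x / δ⌉ : ℝ) - 1) < m + 1 := lt_of_mul_lt_mul_right (hy.1.trans_le hm.2) hδ.le
    have h5 : m ≤ ⌊x / δ⌋ := by norm_cast at h3; omega
    have h6 : ⌈x / δ⌉ ≤ m + 1 := by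
      have : ⌈x / δ⌉ - 1 < m + 1 := by exact_mod_cast h4
      omega
    have h7 := Int.le_floor.1 h5
    have h8 := Int.ceil_le.1 h6
    push_cast at h8
    exact ⟨(le_div_iff₀ hδ).1 h7, (div_le_iff₀ hδ).1 h8⟩
  filter_upwards [Complex.continuous_re.continuousAt.eventually (key z.re),
    Complex.continuous_im.continuousAt.eventually (key z.im)] with w h1 h2 p hp
  exact ⟨h1 _ hp.1, h2 _ hp.2⟩

/-- The union of the squares in `S`. -/
def region (δ : ℝ) (S : Finset (ℤ × ℤ)) : Set ℂ := ⋃ p ∈ S, cell δ p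

variable {S : Finset (ℤ × ℤ)}

theorem mem_region : z ∈ region δ S ↔ ∃ p ∈ S, z ∈ cell δ p := by simp [region]

theorem isClosed_region (δ : ℝ) (S : Finset (ℤ × ℤ)) : IsClosed (region δ S) :=
  S.finite_toSet.isClosed_biUnion fun p _ => isClosed_cell δ p

theorem mem_interior_region (hδ : 0 < δ) :
    z ∈ interior (region δ S) ↔ ∀ p, z ∈ cell δ p → p ∈ S := by
  constructor
  · intro hz p hp
    rw [← closure_openCell hδ] at hp
    obtain ⟨w, hw, hwp⟩ := mem_closure_iff.1 hp _ isOpen_interior hz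
    obtain ⟨q, hq, hwq⟩ := mem_region.1 (interior_subset hw)
    exact eq_of_mem_openCell hδ hwp hwq ▸ hq
  · intro h
    rw [mem_interior_iff_mem_nhds]
    filter_upwards [eventually_mem_cell hδ z] with w hw
    obtain ⟨p, hp⟩ := exists_mem_cell hδ w
    exact mem_region.2 ⟨p, h p (hw p hp), hp⟩

theorem openCell_subset_interior_region (hδ : 0 < δ) (hp : p ∈ S) :
    openCell δ p ⊆ interior (region δ S) := fun _ hz =>
  (mem_interior_region hδ).2 fun _ hq => eq_of_mem_openCell hδ hz hq ▸ hp

theorem closure_interior_region (hδ : 0 < δ) : closure (interior (region δ S)) = region δ S := by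
  refine subset_antisymm ((isClosed_region δ S).closure_subset_iff.2 interior_subset) fun z hz => ?_
  obtain ⟨p, hp, hzp⟩ := mem_region.1 hz
  rw [← closure_openCell hδ] at hzp
  exact closure_mono (openCell_subset_interior_region hδ hp) hzp

theorem mem_frontier_interior_region (hδ : 0 < δ) : z ∈ frontier (interior (region δ S)) ↔
    (∃ p ∈ S, z ∈ cell δ p) ∧ ∃ q ∉ S, z ∈ cell δ q := by
  rw [frontier, closure_interior_region hδ, interior_interior, Set.mem_sdiff, mem_region,
    mem_interior_region hδ]
  push Not
  simp only [and_comm]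

/-! ### The sides of the squares -/

/-- The side number `d` of the square `e.1`, `d = e.2`. -/
def side (δ : ℝ) (e : (ℤ × ℤ) × Fin 4) : Set ℂ :=
  segment ℝ (vertex δ (e.1 + corner e.2)) (vertex δ (e.1 + corner (e.2 + 1)))

theorem vertex_mem_cell (hδ : 0 < δ) (p : ℤ × ℤ) (d : Fin 4) :
    vertex δ (p + corner d) ∈ cell δ p := by
  rw [mem_cell]
  have h0 : ∀ x : ℝ, x * δ ≤ (x + 1) * δ := fun x => by nlinarith
  fin_cases d <;> simp [vertex, corner, h0]

theorem side_subset_cell (hδ : 0 < δ) (p : ℤ × ℤ) (d : Fin 4) : side δ (p, d) ⊆ cell δ p :=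
  (convex_cell δ p).segment_subset (vertex_mem_cell hδ p d) (vertex_mem_cell hδ p (d + 1))

/-- Adjacent squares share a side, numbered d in one and d + 2 in the other, and run through it in
opposite directions. -/
theorem side_neighbor (p : ℤ × ℤ) (d : Fin 4) :
    side δ (p + neighbor d, d + 2) = side δ (p, d) := by
  have h1 := neighbor_add_corner d
  have h2 := neighbor_add_corner (d + 1)
  have h3 : neighbor d + corner (d + 2 + 1) = corner d := by revert d; decide
  simp only [side]
  rw [add_assoc, add_assoc, h1, h3, segment_symm]

theorem mem_segment_of_im_eq {a b c : ℝ} (h : z.im = c) (h1 : a ≤ z.re) (h2 : z.re ≤ b) :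
    z ∈ segment ℝ (⟨a, c⟩ : ℂ) ⟨b, c⟩ := by
  have hz : z.re ∈ segment ℝ a b := by rw [segment_eq_Icc (h1.trans h2)]; exact ⟨h1, h2⟩
  obtain ⟨s, t, hs, ht, hst, e⟩ := hz
  refine ⟨s, t, hs, ht, hst, Complex.ext (by simpa using e) ?_⟩
  simp only [Complex.add_im, Complex.smul_im, smul_eq_mul, h]
  rw [← add_mul, hst, one_mul]

theorem mem_segment_of_re_eq {a b c : ℝ} (h : z.re = c) (h1 : a ≤ z.im) (h2 : z.im ≤ b) :
    z ∈ segment ℝ (⟨c, a⟩ : ℂ) ⟨c, b⟩ := by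
  have hz : z.im ∈ segment ℝ a b := by rw [segment_eq_Icc (h1.trans h2)]; exact ⟨h1, h2⟩
  obtain ⟨s, t, hs, ht, hst, e⟩ := hz
  refine ⟨s, t, hs, ht, hst, Complex.ext ?_ (by simpa using e)⟩
  simp only [Complex.add_re, Complex.smul_re, smul_eq_mul, h]
  rw [← add_mul, hst, one_mul]

theorem cell_inter_cell_subset_side (p : ℤ × ℤ) (d : Fin 4) :
    cell δ p ∩ cell δ (p + neighbor d) ⊆ side δ (p, d) := by
  rintro z ⟨h1, h2⟩
  rw [mem_cell] at h1 h2
  obtain ⟨⟨h3, h4⟩, h5, h6⟩ := h1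
  obtain ⟨⟨h7, h8⟩, h9, h10⟩ := h2
  fin_cases d <;> simp [neighbor, side, vertex, corner] at h7 h8 h9 h10 ⊢
  · exact mem_segment_of_im_eq (le_antisymm (by linarith) h5) h3 h4
  · exact mem_segment_of_re_eq (le_antisymm h4 h7) h5 h6
  · rw [segment_symm]
    exact mem_segment_of_im_eq (le_antisymm h6 h9) h3 h4
  · rw [segment_symm]
    exact mem_segment_of_re_eq (le_antisymm (by linarith) h3) h5 h6

/-- The sides of the squares in `S` which separate `S` from its complement. -/
def boundary (S : Finset (ℤ × ℤ)) : Finset ((ℤ × ℤ) × Fin 4) :=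
  {e ∈ S ×ˢ Finset.univ | e.1 + neighbor e.2 ∉ S}

theorem mem_boundary {e : (ℤ × ℤ) × Fin 4} :
    e ∈ boundary S ↔ e.1 ∈ S ∧ e.1 + neighbor e.2 ∉ S := by simp [boundary]

theorem exists_eq_add_neighbor (hδ : 0 < δ) (hp : z ∈ cell δ p) (hq : z ∈ cell δ q) (hne : p ≠ q)
    (h : p.1 = q.1 ∨ p.2 = q.2) : ∃ d, q = p + neighbor d := by
  have key : ∀ {m n : ℤ} {x : ℝ}, m * δ ≤ x → x ≤ (n + 1) * δ → m ≤ n + 1 :=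
    fun {m n x} h1 h2 => by exact_mod_cast le_of_mul_le_mul_right (h1.trans h2) hδ
  have h1 := key hp.1.1 hq.1.2
  have h2 := key hq.1.1 hp.1.2
  have h3 := key hp.2.1 hq.2.2
  have h4 := key hq.2.1 hp.2.2
  obtain ⟨a, b⟩ := p
  obtain ⟨a', b'⟩ := q
  simp only [ne_eq, Prod.mk.injEq] at *
  rcases h with h | h
  · rcases lt_or_ge b b' with hb | hb
    · exact ⟨2, by simp [neighbor]; omega⟩
    · exact ⟨0, by simp [neighbor]; omega⟩
  · rcases lt_or_ge a a' with ha | ha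
    · exact ⟨1, by simp [neighbor]; omega⟩
    · exact ⟨3, by simp [neighbor]; omega⟩

theorem frontier_interior_region (hδ : 0 < δ) :
    frontier (interior (region δ S)) = ⋃ e ∈ boundary S, side δ e := by
  ext z
  simp only [mem_frontier_interior_region hδ, mem_iUnion, exists_prop]
  constructor
  · rintro ⟨⟨p, hp, hzp⟩, q, hq, hzq⟩
    have key : ∀ {p q}, p ∈ S → q ∉ S → z ∈ cell δ p → z ∈ cell δ q → (p.1 = q.1 ∨ p.2 = q.2) →
        ∃ e ∈ boundary S, z ∈ side δ e := fun {p q} hp hq hzp hzq h => by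
      obtain ⟨d, rfl⟩ := exists_eq_add_neighbor hδ hzp hzq (fun h => hq (h ▸ hp)) h
      exact ⟨(p, d), mem_boundary.2 ⟨hp, hq⟩, cell_inter_cell_subset_side p d ⟨hzp, hzq⟩⟩
    -- The squares p and q may meet only at a corner. The square in the column of q and the row of p
    -- also contains z, and one of the two moves from p through it to q leaves S across a side.
    have hzt : z ∈ cell δ (q.1, p.2) := ⟨hzq.1, hzp.2⟩
    by_cases ht : (q.1, p.2) ∈ S
    · exact key ht hq hzt hzq (Or.inl rfl)
    · exact key hp ht hzp hzt (Or.inr rfl)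
  · rintro ⟨⟨p, d⟩, he, hz⟩
    rw [mem_boundary] at he
    refine ⟨⟨p, he.1, side_subset_cell hδ p d hz⟩, _, he.2, ?_⟩
    rw [← side_neighbor] at hz
    exact side_subset_cell hδ _ _ hz

/-- The sides that are not in the boundary are paired off by crossing to the neighbouring square,
and the two terms of each pair are opposite. -/
theorem sum_boundary {E : Type*} [AddCommGroup E] (S : Finset (ℤ × ℤ))
    (φ : (ℤ × ℤ) × Fin 4 → E) (hφ : ∀ p d, φ (p + neighbor d, d + 2) = -φ (p, d)) :
    ∑ e ∈ boundary S, φ e = ∑ p ∈ S, ∑ d, φ (p, d) := by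
  rw [← Finset.sum_product', ← Finset.sum_filter_add_sum_filter_not (S ×ˢ Finset.univ)
    (fun e => e.1 + neighbor e.2 ∉ S), boundary, left_eq_add]
  have hback : ∀ (p : ℤ × ℤ) d, p + neighbor d + neighbor (d + 2) = p := fun p d => by
    rw [neighbor_add_two, add_neg_cancel_right]
  refine Finset.sum_involution (fun e _ => (e.1 + neighbor e.2, e.2 + 2)) ?_ ?_ ?_ ?_
  · rintro ⟨p, d⟩ _
    rw [hφ, add_neg_cancel]
  · rintro ⟨p, d⟩ _ _ h
    have : d + 2 = d := congrArg Prod.snd h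
    have h2 : ∀ d : Fin 4, d + 2 ≠ d := by decide
    exact h2 d this
  · rintro ⟨p, d⟩ h
    simp only [Finset.mem_filter, Finset.mem_product, Finset.mem_univ, and_true, not_not] at h ⊢
    exact ⟨h.2, by rw [hback]; exact h.1⟩
  · rintro ⟨p, d⟩ _
    exact Prod.ext (hback p d) (add_two_add_two d)

/-! ### Integrals over the boundary of a union of squares -/

variable {E : Type*} [NormedAddCommGroup E] [NormedSpace ℂ E] {f : ℂ → E}

/-- The integral along a side. -/
noncomputable def sideIntegral (δ : ℝ) (f : ℂ → E) (e : (ℤ × ℤ) × Fin 4) : E :=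
  pathIntegral (Path.segment (vertex δ (e.1 + corner e.2)) (vertex δ (e.1 + corner (e.2 + 1)))) f

theorem sideIntegral_neighbor (δ : ℝ) (f : ℂ → E) (p : ℤ × ℤ) (d : Fin 4) :
    sideIntegral δ f (p + neighbor d, d + 2) = -sideIntegral δ f (p, d) := by
  have h1 := neighbor_add_corner d
  have h3 : neighbor d + corner (d + 2 + 1) = corner d := by revert d; decide
  simp only [sideIntegral]
  rw [add_assoc, add_assoc, h1, h3, ← Path.segment_symm, pathIntegral_symm]

/-- A holomorphic function on a convex square has a primitive, whose increments around the four
corners telescope. -/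
theorem sum_sideIntegral_eq_zero [CompleteSpace E] (hδ : 0 < δ)
    (hf : DifferentiableOn ℂ f (cell δ p)) : ∑ d, sideIntegral δ f (p, d) = 0 := by
  obtain ⟨g, hg⟩ := (convex_cell δ p).exists_forall_hasDerivWithinAt hf
  have h : ∀ d, sideIntegral δ f (p, d) =
      g (vertex δ (p + corner (d + 1))) - g (vertex δ (p + corner d)) := fun d => by
    have hs := side_subset_cell hδ p d
    rw [side, ← Path.range_segment] at hs
    exact pathIntegral_of_hasDerivWithinAt (.segment _ _) hs (hf.continuousOn.mono hs) hg
  simp only [h, Finset.sum_sub_distrib]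
  rw [sub_eq_zero]
  exact Equiv.sum_comp (Equiv.addRight (1 : Fin 4)) fun d => g (vertex δ (p + corner d))

/-- Seen from w the segment makes a quarter turn: (z - w)/(a - w) = s + ti with s, t ≥ 0 and s + t =
1. This avoids the cut of the logarithm, which goes from log 1 = 0 to log i = iπ/2. -/
theorem pathIntegral_segment_inv_sub {a b : ℂ} (ha : a ≠ w) (hb : b - w = Complex.I * (a - w)) :
    pathIntegral (Path.segment a b) (fun ζ => (ζ - w)⁻¹) = Real.pi / 2 * Complex.I := by
  have ha' : a - w ≠ 0 := sub_ne_zero.2 ha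
  have hslit : ∀ z ∈ segment ℝ a b, (z - w) / (a - w) ∈ Complex.slitPlane := by
    rintro z ⟨s, t, hs, ht, hst, rfl⟩
    have h1 : (s • a + t • b - w) / (a - w) = s + t * Complex.I := by
      rw [div_eq_iff ha', add_mul, mul_assoc, ← hb]
      have h2 : (s : ℂ) + t = 1 := by exact_mod_cast hst
      simp only [Complex.real_smul]
      linear_combination w * h2
    rw [h1, Complex.mem_slitPlane_iff]
    rcases ht.eq_or_lt with rfl | ht
    · left; simp at hst ⊢; linarith
    · right; simp; exact ht.ne'
  have hne : ∀ z ∈ segment ℝ a b, z - w ≠ 0 := fun z hz h => by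
    have := hslit z hz
    rw [h, zero_div] at this
    simp at this
  have hw : w ∉ range (Path.segment a b) := fun h => by
    rw [Path.range_segment] at h
    exact hne w h (sub_self w)
  rw [pathIntegral_of_hasDerivWithinAt (s := segment ℝ a b)
    (g := fun ζ => Complex.log ((ζ - w) / (a - w))) (.segment a b) (Path.range_segment a b).le
    (Contour.continuousOn_inv_sub hw)]
  · rw [hb, mul_div_cancel_right₀ _ ha', div_self ha', Complex.log_one, Complex.log_I, sub_zero]
  · intro z hz
    have h4 := ((((hasDerivAt_id z).sub_const w).div_const (a - w)).clog
      (hslit z hz)).hasDerivWithinAt (s := segment ℝ a b)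
    refine h4.congr_deriv ?_
    have := hne z hz
    change 1 / (a - w) / ((z - w) / (a - w)) = _
    field_simp

/-- The centre of a square. -/
noncomputable def center (δ : ℝ) (p : ℤ × ℤ) : ℂ := ⟨(p.1 + 1 / 2) * δ, (p.2 + 1 / 2) * δ⟩

theorem center_mem_openCell (hδ : 0 < δ) (p : ℤ × ℤ) : center δ p ∈ openCell δ p := by
  rw [mem_openCell]
  simp only [center]
  refine ⟨⟨?_, ?_⟩, ?_, ?_⟩ <;> nlinarith

/-- Rotation by i about the centre takes each corner to the next, so each side contributes a quarter
turn. -/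
theorem sum_sideIntegral_center (hδ : 0 < δ) (p : ℤ × ℤ) :
    ∑ d, sideIntegral δ (fun ζ => (ζ - center δ p)⁻¹) (p, d) = 2 * Real.pi * Complex.I := by
  have h : ∀ d, sideIntegral δ (fun ζ => (ζ - center δ p)⁻¹) (p, d) = Real.pi / 2 * Complex.I := by
    intro d
    refine pathIntegral_segment_inv_sub ?_ ?_
    · intro h
      have := congrArg Complex.re h
      revert this
      fin_cases d <;> simp [vertex, corner, center] <;> exact hδ.ne'
    · fin_cases d <;> apply Complex.ext <;> simp [vertex, corner, center] <;> ring
  simp only [h, Finset.sum_const, Finset.card_univ, Fintype.card_fin]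
  ring

end Grid

/-! ### The boundary contour of a union of squares -/

namespace Grid

variable {δ : ℝ} {S : Finset (ℤ × ℤ)} {E : Type*} [NormedAddCommGroup E] [NormedSpace ℂ E]
  {f : ℂ → E} {z w : ℂ}

/-- A contour running through the boundary of the union of the squares in `S`. -/
noncomputable def gridContour (δ : ℝ) (S : Finset (ℤ × ℤ)) : Contour :=
  segmentContour
    (fun i : Fin (boundary S).card => vertex δ (((boundary S).equivFin.symm i).1.1 +
      corner ((boundary S).equivFin.symm i).1.2))
    (fun i => vertex δ (((boundary S).equivFin.symm i).1.1 +
      corner (((boundary S).equivFin.symm i).1.2 + 1)))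

theorem sum_equivFin {G : Type*} [AddCommMonoid G] (φ : (ℤ × ℤ) × Fin 4 → G) :
    ∑ i, φ ((boundary S).equivFin.symm i).1 = ∑ e ∈ boundary S, φ e := by
  rw [Equiv.sum_comp (boundary S).equivFin.symm fun e => φ e.1, Finset.univ_eq_attach,
    Finset.sum_attach]

theorem iUnion_equivFin (δ : ℝ) (S : Finset (ℤ × ℤ)) :
    ⋃ i, side δ ((boundary S).equivFin.symm i).1 = ⋃ e ∈ boundary S, side δ e := by
  rw [(boundary S).equivFin.symm.surjective.iUnion_comp fun e => side δ e.1]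
  exact iUnion_subtype _ _

theorem support_gridContour (hδ : 0 < δ) :
    (gridContour δ S).support = frontier (interior (region δ S)) := by
  rw [frontier_interior_region hδ, ← iUnion_equivFin]
  exact support_segmentContour _ _

/-- Both parts use cancellation over shared sides. Applied to differences of values at the ends of a
side, it shows that the boundary segments are balanced; applied to side integrals, it passes to
whole squares. Opposite side integrals cancel for any function, so continuity is needed only on the
boundary. -/
theorem integral_gridContour (hf : ContinuousOn f (gridContour δ S).support) :
    (gridContour δ S).integral f = ∑ p ∈ S, ∑ d, sideIntegral δ f (p, d) := by
  rw [← sum_boundary S _ (sideIntegral_neighbor δ f), ← sum_equivFin]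
  refine integral_segmentContour (fun h => ?_) (hf.mono (support_segmentContour _ _).ge)
  rw [sum_equivFin fun e => h (vertex δ (e.1 + corner e.2)),
    sum_equivFin fun e => h (vertex δ (e.1 + corner (e.2 + 1))), ← sub_eq_zero,
    ← Finset.sum_sub_distrib,
    sum_boundary S fun e => h (vertex δ (e.1 + corner e.2)) - h (vertex δ (e.1 + corner (e.2 + 1)))]
  · refine Finset.sum_eq_zero fun p _ => ?_
    rw [Finset.sum_sub_distrib, sub_eq_zero]
    exact (Equiv.sum_comp (Equiv.addRight (1 : Fin 4)) fun d => h (vertex δ (p + corner d))).symm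
  · intro p d
    have h1 := neighbor_add_corner d
    have h3 : neighbor d + corner (d + 2 + 1) = corner d := by revert d; decide
    simp only
    rw [add_assoc, add_assoc, h1, h3, neg_sub]

theorem support_subset_region (hδ : 0 < δ) : (gridContour δ S).support ⊆ region δ S := by
  rw [support_gridContour hδ]
  exact frontier_subset_closure.trans (closure_interior_region hδ).le

theorem cell_subset_region {p : ℤ × ℤ} (hp : p ∈ S) : cell δ p ⊆ region δ S :=
  subset_biUnion_of_mem (u := fun p => cell δ p) hp

/-- Cauchy's theorem for the boundary of a union of squares. -/
theorem integral_gridContour_eq_zero [CompleteSpace E] (hδ : 0 < δ)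
    (hf : DifferentiableOn ℂ f (region δ S)) : (gridContour δ S).integral f = 0 := by
  rw [integral_gridContour (hf.continuousOn.mono (support_subset_region hδ))]
  exact Finset.sum_eq_zero fun p hp => sum_sideIntegral_eq_zero hδ (hf.mono (cell_subset_region hp))

theorem differentiableOn_inv_sub {s : Set ℂ} (hw : w ∉ s) :
    DifferentiableOn ℂ (fun ζ : ℂ => (ζ - w)⁻¹) s :=
  (differentiableOn_id.sub_const w).inv fun _ hζ h => hw ((sub_eq_zero.1 h : _ = w) ▸ hζ)

theorem index_gridContour_of_notMem (hδ : 0 < δ) (hw : w ∉ region δ S) :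
    (gridContour δ S).index w = 0 := by
  rw [Contour.index, integral_gridContour_eq_zero hδ (differentiableOn_inv_sub hw), mul_zero]

theorem notMem_support_of_mem_interior (hδ : 0 < δ) (hw : w ∈ interior (region δ S)) :
    w ∉ (gridContour δ S).support := by
  rw [support_gridContour hδ]
  exact fun h => h.2 (by rwa [interior_interior])

/-- Only the square p contributes: (ζ - c)⁻¹ is holomorphic on every other square of S. -/
theorem index_gridContour_center (hδ : 0 < δ) {p : ℤ × ℤ} (hp : p ∈ S) :
    (gridContour δ S).index (center δ p) = 1 := by
  have hc := center_mem_openCell hδ p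
  have hs := notMem_support_of_mem_interior hδ (openCell_subset_interior_region hδ hp hc)
  rw [Contour.index, integral_gridContour (Contour.continuousOn_inv_sub hs),
    Finset.sum_eq_single_of_mem p hp, sum_sideIntegral_center hδ p,
    inv_mul_cancel₀ Complex.two_pi_I_ne_zero]
  intro q _ hq
  exact sum_sideIntegral_eq_zero hδ
    (differentiableOn_inv_sub fun h => hq (eq_of_mem_openCell hδ hc h))

theorem index_gridContour_of_mem_openCell (hδ : 0 < δ) {p : ℤ × ℤ} (hp : p ∈ S)
    (hw : w ∈ openCell δ p) : (gridContour δ S).index w = 1 := by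
  rw [← index_gridContour_center hδ hp]
  -- The index is locally constant off the contour, so it has derivative 0 and is constant on the
  -- connected open square.
  have hd : ∀ x ∈ openCell δ p, HasDerivAt (gridContour δ S).index 0 x := fun x hx =>
    (hasDerivAt_const x _).congr_of_eventuallyEq (Contour.eventually_index_eq
      (notMem_support_of_mem_interior hδ (openCell_subset_interior_region hδ hp hx)))
  have hconv : Convex ℝ (openCell δ p) := ((convex_Ioo _ _).linear_preimage Complex.reLm).inter
    ((convex_Ioo _ _).linear_preimage Complex.imLm)
  exact (isOpen_openCell δ p).is_const_of_deriv_eq_zero hconv.isPreconnected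
    (fun x hx => (hd x hx).differentiableAt.differentiableWithinAt) (fun x hx => (hd x hx).deriv)
    hw (center_mem_openCell hδ p)

/-- An interior point may lie on grid lines. The index is constant near it, and points of an open
square of S are arbitrarily close. -/
theorem index_gridContour_of_mem (hδ : 0 < δ) (hw : w ∈ interior (region δ S)) :
    (gridContour δ S).index w = 1 := by
  obtain ⟨p, hp⟩ := exists_mem_cell hδ w
  have hpS := (mem_interior_region hδ).1 hw p hp
  rw [← closure_openCell hδ] at hp
  obtain ⟨x, hx, hxp⟩ := mem_closure_iff_nhds.1 hp _
    (Contour.eventually_index_eq (notMem_support_of_mem_interior hδ hw))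
  exact (mem_ofPred.1 hx).symm.trans (index_gridContour_of_mem_openCell hδ hpS hxp)

theorem isBoundaryOfCauchyDomain (hδ : 0 < δ) {U : Set ℂ} (hU : region δ S ⊆ U) :
    (gridContour δ S).IsBoundaryOfCauchyDomain U (interior (region δ S)) where
  isOpen := isOpen_interior
  closure_subset := by rwa [closure_interior_region hδ]
  frontier_eq := (support_gridContour hδ).symm
  index_inside _ hw := index_gridContour_of_mem hδ hw
  index_outside w hw := index_gridContour_of_notMem hδ (by rwa [closure_interior_region hδ] at hw)

theorem exists_region {K U : Set ℂ} (hK : IsCompact K) (hU : IsOpen U) (hKU : K ⊆ U) :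
    ∃ δ > 0, ∃ S, K ⊆ interior (region δ S) ∧ region δ S ⊆ U := by
  obtain ⟨ε, hε, hKε⟩ := hK.exists_thickening_subset_open hU hKU
  -- Points of one square are at distance at most 2δ < ε, so a square that meets K stays in the
  -- ε-thickening of K.
  have hδ : 0 < ε / 3 := by positivity
  set δ := ε / 3 with hδε
  have hfin : {p | (cell δ p ∩ K).Nonempty}.Finite := by
    obtain ⟨R, hR⟩ := hK.isBounded.exists_norm_le
    refine ((finite_Icc ⌊-R / δ - 1⌋ ⌈R / δ⌉).prod (finite_Icc ⌊-R / δ - 1⌋ ⌈R / δ⌉)).subset ?_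
    rintro p ⟨z, hz, hzK⟩
    have key : ∀ {m : ℤ} {x : ℝ}, |x| ≤ R → m * δ ≤ x → x ≤ (m + 1) * δ →
        m ∈ Icc ⌊-R / δ - 1⌋ ⌈R / δ⌉ := fun {m x} hx h1 h2 => by
      rw [abs_le] at hx
      constructor
      · have : -R / δ ≤ m + 1 := (div_le_iff₀ hδ).2 (by linarith)
        exact Int.cast_le.1 ((Int.floor_le _).trans (by linarith : -R / δ - 1 ≤ (m : ℝ)))
      · have : m ≤ R / δ := (le_div_iff₀ hδ).2 (by linarith)
        exact Int.cast_le.1 (this.trans (Int.le_ceil _))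
    exact ⟨key ((Complex.abs_re_le_norm z).trans (hR z hzK)) hz.1.1 hz.1.2,
      key ((Complex.abs_im_le_norm z).trans (hR z hzK)) hz.2.1 hz.2.2⟩
  refine ⟨δ, hδ, hfin.toFinset, fun z hz => ?_, fun z hz => ?_⟩
  · exact (mem_interior_region hδ).2 fun p hp => hfin.mem_toFinset.2 ⟨z, hp, hz⟩
  · obtain ⟨p, hp, hzp⟩ := mem_region.1 hz
    obtain ⟨x, hxp, hxK⟩ := hfin.mem_toFinset.1 hp
    refine hKε (Metric.mem_thickening_iff.2 ⟨x, hxK, ?_⟩)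
    have := dist_le_of_mem_cell hzp hxp
    linarith

/-- Cauchy's integral formula for the boundary of a union of squares. -/
theorem integral_inv_sub_smul_gridContour [CompleteSpace E] (hδ : 0 < δ) {U : Set ℂ}
    (hU : IsOpen U) (hSU : region δ S ⊆ U) (hf : DifferentiableOn ℂ f U)
    (hz : z ∈ interior (region δ S)) :
    (gridContour δ S).integral (fun ζ => (ζ - z)⁻¹ • f ζ) = (2 * Real.pi * Complex.I) • f z := by
  have hzs := notMem_support_of_mem_interior hδ hz
  have hzU : U ∈ 𝓝 z := hU.mem_nhds (hSU (interior_subset hz))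
  -- The difference quotient of f at z, with the value f'(z) at z itself, is holomorphic on U, so
  -- its boundary integral vanishes.
  have h0 := integral_gridContour_eq_zero hδ
    (((Complex.differentiableOn_dslope hzU).2 hf).mono hSU)
  have hc := Contour.continuousOn_inv_sub hzs
  have hfc := hf.continuousOn.mono ((support_subset_region hδ).trans hSU)
  rw [Contour.integral_congr (g := fun ζ => (ζ - z)⁻¹ • f ζ - (ζ - z)⁻¹ • f z),
    Contour.integral_sub (f := fun ζ => (ζ - z)⁻¹ • f ζ) (g := fun ζ => (ζ - z)⁻¹ • f z)
      (hc.smul hfc) (hc.smul continuousOn_const), sub_eq_zero,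
    Contour.integral_smul_const] at h0
  · have h1 := index_gridContour_of_mem hδ hz
    rw [Contour.index, inv_mul_eq_one₀ Complex.two_pi_I_ne_zero] at h1
    rw [h0, h1]
  · intro ζ hζ
    rw [dslope_of_ne _ (ne_of_mem_of_not_mem hζ hzs), slope_def_module, smul_sub]

end Grid

/-! ### The homological Cauchy theorem -/

namespace Contour

variable {E : Type*} [NormedAddCommGroup E] [NormedSpace ℂ E] [CompleteSpace E]
  {Γ Γ' : Contour} {f : ℂ → E}

/-- Write f on Γ by Cauchy's formula over the surrounding grid boundary and exchange the integrals.
The inner integral of (ζ - z)⁻¹ in z is -2πi times the index of Γ about ζ. Thus Γ enters only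
through its winding numbers on the grid boundary. -/
theorem integral_eq_neg_integral_gridContour {δ : ℝ} {S : Finset (ℤ × ℤ)} (hδ : 0 < δ) {U : Set ℂ}
    (hU : IsOpen U) (hSU : Grid.region δ S ⊆ U) (hf : DifferentiableOn ℂ f U)
    (hΓ : Γ.support ⊆ interior (Grid.region δ S)) :
    Γ.integral f = -(Grid.gridContour δ S).integral fun ζ => Γ.index ζ • f ζ := by
  have h2 := Complex.two_pi_I_ne_zero
  have hfc := hf.continuousOn.mono ((Grid.support_subset_region hδ).trans hSU)
  rw [integral_congr (g := fun z => (2 * Real.pi * Complex.I : ℂ)⁻¹ •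
    (Grid.gridContour δ S).integral (fun ζ => (ζ - z)⁻¹ • f ζ)), integral_smul, integral_swap]
  · simp only [integral_smul_const]
    rw [← integral_smul, ← neg_one_smul ℂ, ← integral_smul]
    refine integral_congr fun ζ _ => ?_
    have e : Γ.integral (fun z => (ζ - z)⁻¹) = (-1 : ℂ) • Γ.integral fun z => (z - ζ)⁻¹ := by
      rw [← integral_smul]
      congr 1
      ext z
      rw [smul_eq_mul, neg_one_mul, ← inv_neg, neg_sub]
    rw [smul_smul, smul_smul, index, e, smul_eq_mul]
    congr 1
    ring
  · have hne : ∀ x ∈ Γ.support ×ˢ (Grid.gridContour δ S).support, x.2 - x.1 ≠ 0 := fun x hx h =>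
      Grid.notMem_support_of_mem_interior hδ (hΓ hx.1) (sub_eq_zero.1 h ▸ hx.2)
    exact ((continuousOn_snd.sub continuousOn_fst).inv₀ hne).smul
      (hfc.comp continuousOn_snd fun x hx => hx.2)
  · intro z hz
    rw [Grid.integral_inv_sub_smul_gridContour hδ hU hSU hf (hΓ hz), inv_smul_smul₀ h2]

/-- The homological form of Cauchy's theorem. -/
theorem integral_eq_of_index_eq {U : Set ℂ} (hU : IsOpen U) (hf : DifferentiableOn ℂ f U)
    (hΓ : Γ.support ⊆ U) (hΓ' : Γ'.support ⊆ U) (h : ∀ w ∉ U, Γ.index w = Γ'.index w) :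
    Γ.integral f = Γ'.integral f := by
  -- K is compact: off the supports both indices are locally constant, and far away both vanish. A
  -- grid boundary around K avoids K, so the two indices agree along it.
  set K : Set ℂ := Γ.support ∪ Γ'.support ∪ {w | Γ.index w ≠ Γ'.index w} with hKdef
  have hKU : K ⊆ U := union_subset (union_subset hΓ hΓ') fun w hw => by
    by_contra hwU
    exact hw (h w hwU)
  have hKclosed : IsClosed K := by
    rw [← isOpen_compl_iff, isOpen_iff_mem_nhds]
    intro w hw
    simp only [hKdef, compl_union, mem_inter_iff, mem_compl_iff, mem_ofPred, not_not] at hw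
    filter_upwards [eventually_index_eq hw.1.1, eventually_index_eq hw.1.2,
      Γ.isCompact_support.isClosed.isOpen_compl.mem_nhds hw.1.1,
      Γ'.isCompact_support.isClosed.isOpen_compl.mem_nhds hw.1.2] with x h1 h2 h3 h4
    simp only [hKdef, compl_union, mem_inter_iff, mem_compl_iff, mem_ofPred, not_not]
    exact ⟨⟨h3, h4⟩, by rw [h1, h2, hw.2]⟩
  have hK : IsCompact K := by
    obtain ⟨R, hR⟩ := (Γ.isCompact_support.union Γ'.isCompact_support).isBounded.exists_norm_le
    refine Metric.isCompact_of_isClosed_isBounded hKclosed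
      (isBounded_iff_forall_norm_le.2 ⟨R, fun w hw => ?_⟩)
    rcases hw with hw | hw
    · exact hR w hw
    · by_contra! hlt
      exact hw (by rw [index_eq_zero_of_forall_norm_lt fun ζ hζ => (hR ζ (Or.inl hζ)).trans_lt hlt,
        index_eq_zero_of_forall_norm_lt fun ζ hζ => (hR ζ (Or.inr hζ)).trans_lt hlt])
  obtain ⟨δ, hδ, S, hKS, hSU⟩ := Grid.exists_region hK hU hKU
  rw [integral_eq_neg_integral_gridContour hδ hU hSU hf fun z hz => hKS (Or.inl (Or.inl hz)),
    integral_eq_neg_integral_gridContour hδ hU hSU hf fun z hz => hKS (Or.inl (Or.inr hz))]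
  congr 1
  refine integral_congr fun ζ hζ => ?_
  have : ¬Γ.index ζ ≠ Γ'.index ζ := fun hne =>
    Grid.notMem_support_of_mem_interior hδ (hKS (Or.inr hne)) hζ
  rw [not_not.1 this]

end Contour

/-! ### Completeness, the operation ♭ and spectra on the complexification -/

namespace Complexification

@[simp] theorem sub_re {V : Type*} [AddCommGroup V] (z w : Complexification V) :
    (z - w).re = z.re - w.re := by
  rw [sub_eq_add_neg, add_re, neg_re, sub_eq_add_neg]

@[simp] theorem sub_im {V : Type*} [AddCommGroup V] (z w : Complexification V) :
    (z - w).im = z.im - w.im := by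
  rw [sub_eq_add_neg, add_im, neg_im, sub_eq_add_neg]

variable {V : Type*} [NormedAddCommGroup V] [NormedSpace ℝ V]

/-- A real-linear L is the pairing with L(1) - iL(i). Hence V_ℂ is isometric to the space of bounded
real-linear maps ℂ → V and inherits completeness from it. -/
theorem rePairingHom_surjective : Function.Surjective (rePairingHom V) := fun L => by
  refine ⟨⟨L 1, -L Complex.I⟩, ContinuousLinearMap.ext fun c => ?_⟩
  have h : c = c.re • (1 : ℂ) + c.im • Complex.I := by
    simp only [Complex.real_smul, mul_one, Complex.re_add_im]
  calc c.re • L 1 - c.im • -L Complex.I = L (c.re • (1 : ℂ) + c.im • Complex.I) := by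
        rw [map_add, map_smul, map_smul, smul_neg, sub_neg_eq_add]
    _ = L c := by rw [← h]

instance [CompleteSpace V] : CompleteSpace (Complexification V) :=
  ((AddMonoidHomClass.isometry_of_norm (rePairingHom V) fun _ =>
    rfl).isUniformInducing.completeSpace_congr rePairingHom_surjective).2 inferInstance

@[simp] theorem conj_re (z : Complexification V) : (conj V z).re = z.re := rfl

@[simp] theorem conj_im (z : Complexification V) : (conj V z).im = -z.im := rfl

@[simp] theorem conj_conj (z : Complexification V) : conj V (conj V z) = z := by ext <;> simp

@[simp] theorem extend_re (T : V →L[ℝ] V) (z : Complexification V) :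
    (extend T z).re = T z.re := rfl

@[simp] theorem extend_im (T : V →L[ℝ] V) (z : Complexification V) :
    (extend T z).im = T z.im := rfl

theorem flat_apply (S : Complexification V →L[ℂ] Complexification V) (z : Complexification V) :
    flat S z = conj V (S (conj V z)) := rfl

/-- `extend` as a homomorphism of monoids. -/
noncomputable def extendHom (V : Type*) [NormedAddCommGroup V] [NormedSpace ℝ V] :
    (V →L[ℝ] V) →* (Complexification V →L[ℂ] Complexification V) where
  toFun := extend
  map_one' := by ext z <;> simp
  map_mul' A B := by ext z <;> simp

/-- `flat` as a homomorphism of monoids. -/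
noncomputable def flatHom (V : Type*) [NormedAddCommGroup V] [NormedSpace ℝ V] :
    (Complexification V →L[ℂ] Complexification V) →*
      (Complexification V →L[ℂ] Complexification V) where
  toFun := flat
  map_one' := by ext z <;> simp [flat_apply]
  map_mul' A B := by ext z <;> simp [flat_apply]

/-- `flat` as a continuous conjugate-linear map. -/
noncomputable def flatL (V : Type*) [NormedAddCommGroup V] [NormedSpace ℝ V] :
    (Complexification V →L[ℂ] Complexification V) →SL[starRingEnd ℂ]
      (Complexification V →L[ℂ] Complexification V) :=
  LinearMap.mkContinuous
    { toFun := flat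
      map_add' := fun A B => by ext z <;> simp [flat_apply]
      map_smul' := fun c A => ContinuousLinearMap.ext fun z => by
        simp only [flat_apply, _root_.smul_apply, map_smulₛₗ] } (‖conj V‖ * ‖conj V‖)
    fun S => by
      calc ‖((conj V).comp S).comp (conj V)‖ ≤ ‖conj V‖ * ‖S‖ * ‖conj V‖ :=
            (ContinuousLinearMap.opNorm_comp_le _ _).trans (mul_le_mul_of_nonneg_right
              (ContinuousLinearMap.opNorm_comp_le _ _) (norm_nonneg _))
        _ = _ := by ring

theorem flat_extend (T : V →L[ℝ] V) : flat (extend T) = extend T := by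
  ext z <;> simp [flat_apply]

theorem flat_algebraMap_sub (ζ : ℂ) (S : Complexification V →L[ℂ] Complexification V) :
    flat (algebraMap ℂ _ ζ - S) = algebraMap ℂ _ (starRingEnd ℂ ζ) - flat S := by
  have h : flatL V (algebraMap ℂ _ ζ - S) = algebraMap ℂ _ (starRingEnd ℂ ζ) - flatL V S := by
    rw [map_sub, Algebra.algebraMap_eq_smul_one, map_smulₛₗ, Algebra.algebraMap_eq_smul_one]
    congr 2
    exact map_one (flatHom V)
  exact h

theorem notMem_spectrum_conj {S : Complexification V →L[ℂ] Complexification V} (hS : flat S = S)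
    {ζ : ℂ} (h : ζ ∉ spectrum ℂ S) : starRingEnd ℂ ζ ∉ spectrum ℂ S := by
  rw [spectrum.notMem_iff] at h ⊢
  have := h.map (flatHom V)
  rwa [show flatHom V _ = flat _ from rfl, flat_algebraMap_sub, hS] at this

/-- As ♭ is multiplicative and sends ζ - S to its conjugate counterpart, it carries inverse to
inverse. -/
theorem flat_resolvent {S : Complexification V →L[ℂ] Complexification V} (hS : flat S = S)
    {ζ : ℂ} (h : ζ ∉ spectrum ℂ S) : flat (resolvent S ζ) = resolvent S (starRingEnd ℂ ζ) := by
  have h' := notMem_spectrum_conj hS h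
  rw [spectrum.notMem_iff] at h h'
  have h1 : flat (algebraMap ℂ _ ζ - S) * flat (resolvent S ζ) = 1 := by
    have := congrArg (flatHom V) (Ring.mul_inverse_cancel _ h)
    rwa [map_mul, map_one] at this
  rw [flat_algebraMap_sub, hS] at h1
  calc flat (resolvent S ζ) = resolvent S (starRingEnd ℂ ζ) * (algebraMap ℂ _ (starRingEnd ℂ ζ) - S) *
        flat (resolvent S ζ) := by
        rw [show resolvent S (starRingEnd ℂ ζ) * _ = 1 from Ring.inverse_mul_cancel _ h', one_mul]
    _ = _ := by rw [mul_assoc, h1, mul_one]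

/-- For z = u + iv the extension of (u - T)² + v² factors as (z - T_ℂ)(z̄ - T_ℂ). The factors
commute, so invertibility of the product gives that of z - T_ℂ. -/
theorem spectrum_extend_subset (T : V →L[ℝ] V) :
    spectrum ℂ (extend T) ⊆ complexSpectrum T := by
  intro z hz hu
  rw [spectrum.mem_iff] at hz
  have h := hu.map (extendHom V)
  have e : extendHom V ((algebraMap ℝ _ z.re - T) ^ 2 + algebraMap ℝ _ (z.im ^ 2)) =
      (algebraMap ℂ _ z - extend T) * (algebraMap ℂ _ (starRingEnd ℂ z) - extend T) := by
    change extend _ = _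
    rw [pow_two]
    ext x <;>
    simp only [extend_re, extend_im, _root_.add_apply, mul_apply_eq_comp,
      _root_.sub_apply, Algebra.algebraMap_eq_smul_one, _root_.smul_apply,
      one_apply_eq_self, sub_re, sub_im, smul_re, smul_im, Complex.conj_re,
      Complex.conj_im, map_sub, map_smul] <;> module
  rw [e] at h
  have hc : Commute (algebraMap ℂ _ z - extend T) (algebraMap ℂ _ (starRingEnd ℂ z) - extend T) :=
    ((Algebra.commute_algebraMap_left _ _).sub_right (Algebra.commute_algebraMap_left _ _)).sub_left
      ((Algebra.commute_algebraMap_right _ _).sub_right (Commute.refl _))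
  exact hz (hc.isUnit_mul_iff.1 h).1

theorem mapsTo_realSubspace {R : Complexification V →L[ℂ] Complexification V} (hR : flat R = R) :
    MapsTo R (realSubspace V) (realSubspace V) := by
  rintro _ ⟨x, rfl⟩
  have h : conj V (R (conj V ⟨x, 0⟩)) = R ⟨x, 0⟩ := DFunLike.congr_fun hR _
  have hx : conj V ⟨x, 0⟩ = ⟨x, 0⟩ := by ext <;> simp
  rw [hx] at h
  have him := congrArg im h
  -- The image of a real vector is fixed by C, so its imaginary part equals its own negative.
  rw [conj_im, neg_eq_iff_add_eq_zero, ← two_smul ℝ, smul_eq_zero_iff_right two_ne_zero] at him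
  exact ⟨(R ⟨x, 0⟩).re, by ext <;> simp [him]⟩

end Complexification

/-! ### Contour integrals under complex conjugation -/

section Conjugation

variable {E : Type*} [NormedAddCommGroup E] [NormedSpace ℂ E] [CompleteSpace E] {f g : ℂ → E}

theorem pathIntegral_map_conj {a b : ℂ} {γ : Path a b} (hγ : IsPiecewiseSmooth γ)
    (L : E →SL[starRingEnd ℂ] E) (hf : ContinuousOn f (range γ))
    (hg : ∀ ζ ∈ range γ, g (starRingEnd ℂ ζ) = L (f ζ)) :
    pathIntegral (γ.map (Complex.conjCLE : ℂ →L[ℝ] ℂ).continuous) g = L (pathIntegral γ f) := by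
  have hi := hγ.intervalIntegrable hf
  rw [intervalIntegrable_iff_integrableOn_Ioc_of_le zero_le_one] at hi
  rw [pathIntegral_eq, pathIntegral_eq, intervalIntegral.integral_of_le zero_le_one,
    intervalIntegral.integral_of_le zero_le_one,
    ← ContinuousLinearMap.integral_comp_commSL (fun r x => by simp) L hi]
  refine integral_congr_ae (Eventually.of_forall fun t => ?_)
  have h1 : deriv (fun s => starRingEnd ℂ (γ.extend s)) t = starRingEnd ℂ (deriv γ.extend t) := deriv.star
  have h2 : γ.extend t ∈ range γ := by rw [← γ.extend_range]; exact mem_range_self t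
  change deriv (fun s => starRingEnd ℂ (γ.extend s)) t • g (starRingEnd ℂ (γ.extend t)) = _
  rw [h1, hg _ h2]
  exact (map_smulₛₗ L _ _).symm

namespace Contour

/-- The complex conjugate of a contour, with orientations reversed. -/
noncomputable def conj (Γ : Contour) : Contour where
  num := Γ.num
  base j := Complex.conjCLE (Γ.base j)
  curve j := ((Γ.curve j).map (Complex.conjCLE : ℂ →L[ℝ] ℂ).continuous).symm
  piecewiseSmooth j := ((Γ.piecewiseSmooth j).map _).symm

variable {Γ : Contour}

theorem mem_support_conj {ζ : ℂ} : ζ ∈ Γ.conj.support ↔ starRingEnd ℂ ζ ∈ Γ.support := by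
  simp only [support, mem_iUnion]
  refine exists_congr fun j => ?_
  change ζ ∈ range ((Γ.curve j).map (Complex.conjCLE : ℂ →L[ℝ] ℂ).continuous).symm ↔ _
  rw [Path.symm_range]
  exact exists_congr fun t => ⟨fun h => by rw [← h]; exact (Complex.conj_conj _).symm,
    fun h => by rw [← Complex.conj_conj ζ, ← h]; rfl⟩

/-- Mirroring the curves conjugates γ', which matches the conjugate-linearity of L; the minus sign
comes from the reversal. -/
theorem integral_conj (L : E →SL[starRingEnd ℂ] E) (hf : ContinuousOn f Γ.support)
    (hg : ∀ ζ ∈ Γ.support, g (starRingEnd ℂ ζ) = L (f ζ)) :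
    Γ.conj.integral g = -L (Γ.integral f) := by
  rw [integral_eq_sum, integral_eq_sum, map_sum, ← Finset.sum_neg_distrib]
  refine Finset.sum_congr rfl fun j _ => ?_
  rw [← pathIntegral_map_conj (Γ.piecewiseSmooth j) L (hf.mono (Γ.range_subset_support j))
    fun ζ hζ => hg ζ (Γ.range_subset_support j hζ)]
  exact pathIntegral_symm _ _

theorem conj_inv_two_pi_I : starRingEnd ℂ (2 * Real.pi * Complex.I)⁻¹ =
    -(2 * Real.pi * Complex.I)⁻¹ := by
  rw [map_inv₀, map_mul, Complex.conj_I, mul_neg, inv_neg, map_mul, Complex.conj_ofReal,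
    Complex.conj_ofNat]

/-- The signs from reversal and from conjugating (2πi)⁻¹ cancel, so the mirrored contour is again
positively oriented. -/
theorem index_conj {w : ℂ} (hw : starRingEnd ℂ w ∉ Γ.support) :
    Γ.conj.index w = starRingEnd ℂ (Γ.index (starRingEnd ℂ w)) := by
  rw [index, index, map_mul, conj_inv_two_pi_I,
    integral_conj (f := fun ζ => (ζ - starRingEnd ℂ w)⁻¹)
      (starL ℂ : ℂ ≃L⋆[ℂ] ℂ).toContinuousLinearMap (continuousOn_inv_sub hw), mul_neg, neg_mul]
  · rfl
  · intro ζ _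
    change _ = starRingEnd ℂ (ζ - starRingEnd ℂ w)⁻¹
    rw [map_inv₀, map_sub, Complex.conj_conj]

end Contour

end Conjugation

/-! ### The Riesz-Dunford integral: independence of the contour and symmetry -/

section Main

open Complexification

theorem Contour.IsBoundaryOfCauchyDomain.support_subset {Γ : Contour} {U Δ s : Set ℂ}
    (h : Γ.IsBoundaryOfCauchyDomain U Δ) (hs : s ⊆ Δ) : Γ.support ⊆ U \ s := by
  rw [← h.frontier_eq]
  exact fun z hz => ⟨h.closure_subset (frontier_subset_closure hz),
    fun hzs => hz.2 (h.isOpen.interior_eq.symm ▸ hs hzs)⟩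

theorem Contour.exists_isBoundaryOfCauchyDomain {K U : Set ℂ} (hK : IsCompact K) (hU : IsOpen U)
    (hKU : K ⊆ U) : ∃ (Δ : Set ℂ) (Γ : Contour), Γ.IsBoundaryOfCauchyDomain U Δ ∧ K ⊆ Δ := by
  obtain ⟨δ, hδ, S, hKS, hSU⟩ := Grid.exists_region hK hU hKU
  exact ⟨_, _, Grid.isBoundaryOfCauchyDomain hδ hSU, hKS⟩

variable {W : Type*} [NormedAddCommGroup W] [NormedSpace ℂ W] [CompleteSpace W]

theorem differentiableOn_mul_resolvent {U : Set ℂ} {F : ℂ → W →L[ℂ] W}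
    (hF : AnalyticOnNhd ℂ F U) (S : W →L[ℂ] W) :
    DifferentiableOn ℂ (fun ζ => F ζ * resolvent S ζ) (U \ spectrum ℂ S) := fun ζ hζ =>
  ((hF ζ hζ.1).differentiableAt.mul
    (spectrum.hasDerivAt_resolvent_const_left
      (spectrum.notMem_iff.1 hζ.2)).differentiableAt).differentiableWithinAt

theorem Contour.rieszDunford_eq {U Δ Δ' : Set ℂ} (hU : IsOpen U) {F : ℂ → W →L[ℂ] W}
    (hF : AnalyticOnNhd ℂ F U) {S : W →L[ℂ] W} {Γ Γ' : Contour}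
    (h : Γ.IsBoundaryOfCauchyDomain U Δ) (hS : spectrum ℂ S ⊆ Δ)
    (h' : Γ'.IsBoundaryOfCauchyDomain U Δ') (hS' : spectrum ℂ S ⊆ Δ') :
    Γ.rieszDunford F S = Γ'.rieszDunford F S := by
  unfold Contour.rieszDunford
  congr 1
  refine Contour.integral_eq_of_index_eq (hU.sdiff (spectrum.isClosed S))
    (differentiableOn_mul_resolvent hF S) (h.support_subset hS) (h'.support_subset hS')
    fun w hw => ?_
  -- A point outside U \ σ(S) lies in σ(S), where both indices are 1, or off U, where both are 0.
  by_cases hwS : w ∈ spectrum ℂ S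
  · rw [h.index_inside w (hS hwS), h'.index_inside w (hS' hwS)]
  · have hwU : w ∉ U := fun hwU => hw ⟨hwU, hwS⟩
    rw [h.index_outside w fun hc => hwU (h.closure_subset hc),
      h'.index_outside w fun hc => hwU (h'.closure_subset hc)]

theorem flat_rieszDunford {V : Type*} [NormedAddCommGroup V] [NormedSpace ℝ V] [CompleteSpace V]
    {U Δ : Set ℂ} (hU : IsOpen U) (hUconj : ∀ ζ ∈ U, (starRingEnd ℂ) ζ ∈ U)
    {F : ℂ → Complexification V →L[ℂ] Complexification V} (hF : AnalyticOnNhd ℂ F U)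
    (hFconj : ∀ ζ ∈ U, flat (F ζ) = F ((starRingEnd ℂ) ζ))
    {S : Complexification V →L[ℂ] Complexification V} (hflat : flat S = S) {Γ : Contour}
    (h : Γ.IsBoundaryOfCauchyDomain U Δ) (hS : spectrum ℂ S ⊆ Δ) :
    flat (Γ.rieszDunford F S) = Γ.rieszDunford F S := by
  have hsupp := h.support_subset hS
  have hconj : ∀ w, w ∈ U \ spectrum ℂ S → starRingEnd ℂ w ∈ U \ spectrum ℂ S := fun w hw =>
    ⟨hUconj w hw.1, notMem_spectrum_conj hflat hw.2⟩
  have hd := differentiableOn_mul_resolvent hF S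
  have h1 : Γ.conj.integral (fun ζ => F ζ * resolvent S ζ) =
      -flatL V (Γ.integral fun ζ => F ζ * resolvent S ζ) :=
    Contour.integral_conj (flatL V) (hd.continuousOn.mono hsupp) fun ζ hζ => by
      change _ = flatHom V _
      rw [map_mul]
      change _ = flat (F ζ) * flat (resolvent S ζ)
      rw [hFconj ζ (hsupp hζ).1, flat_resolvent hflat (hsupp hζ).2]
  have hsupp' : Γ.conj.support ⊆ U \ spectrum ℂ S := fun ζ hζ => by
    rw [← Complex.conj_conj ζ]
    exact hconj _ (hsupp (Contour.mem_support_conj.1 hζ))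
  -- The mirrored contour need not be shown to bound a Cauchy domain; comparing winding numbers on
  -- σ(S) and off U is enough.
  have h2 : Γ.conj.integral (fun ζ => F ζ * resolvent S ζ) =
      Γ.integral fun ζ => F ζ * resolvent S ζ := by
    refine Contour.integral_eq_of_index_eq (hU.sdiff (spectrum.isClosed S)) hd hsupp' hsupp
      fun w hw => ?_
    have hw' : starRingEnd ℂ w ∉ U \ spectrum ℂ S := fun hc => hw (by
      rw [← Complex.conj_conj w]; exact hconj _ hc)
    rw [Contour.index_conj fun hc => hw' (hsupp hc)]
    have hout : ∀ w, w ∉ U → Γ.index w = 0 := fun w hw =>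
      h.index_outside w fun hc => hw (h.closure_subset hc)
    by_cases hwS : w ∈ spectrum ℂ S
    · have hwS' : starRingEnd ℂ w ∈ spectrum ℂ S := by
        by_contra hc
        exact absurd (notMem_spectrum_conj hflat hc) (by rwa [Complex.conj_conj, not_not])
      rw [h.index_inside _ (hS hwS'), h.index_inside _ (hS hwS), map_one]
    · have hwU : w ∉ U := fun hc => hw ⟨hc, hwS⟩
      have hwU' : starRingEnd ℂ w ∉ U := fun hc => hwU (by
        rw [← Complex.conj_conj w]; exact hUconj _ hc)
      rw [hout _ hwU, hout _ hwU', map_zero]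
  have h3 : flatL V (Γ.rieszDunford F S) = Γ.rieszDunford F S := by
    -- The sign of the conjugated (2πi)⁻¹ is absorbed by the sign in `h1`.
    rw [Contour.rieszDunford, map_smulₛₗ, Contour.conj_inv_two_pi_I, neg_smul, ← smul_neg, ← h1, h2]
  exact h3

end Main

theorem theorem3p1 {V : Type*} [NormedAddCommGroup V] [NormedSpace ℝ V] [CompleteSpace V]
    (U : Set ℂ) (hU : IsOpen U) (hUconj : ∀ ζ ∈ U, (starRingEnd ℂ) ζ ∈ U)
    (F : ℂ → Complexification V →L[ℂ] Complexification V)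
    (hF : AnalyticOnNhd ℂ F U)
    (hFconj : ∀ ζ ∈ U, Complexification.flat (F ζ) = F ((starRingEnd ℂ) ζ))
    (T : V →L[ℝ] V) (hT : complexSpectrum T ⊆ U) :
    (∃ (Δ : Set ℂ) (Γ : Contour), Γ.IsBoundaryOfCauchyDomain U Δ ∧
      spectrum ℂ (Complexification.extend T) ⊆ Δ) ∧
    ∃ R : Complexification V →L[ℂ] Complexification V,
      (∀ (Δ : Set ℂ) (Γ : Contour), Γ.IsBoundaryOfCauchyDomain U Δ →
        spectrum ℂ (Complexification.extend T) ⊆ Δ →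
        Γ.rieszDunford F (Complexification.extend T) = R) ∧
      Complexification.flat R = R ∧
      Set.MapsTo R (Complexification.realSubspace V) (Complexification.realSubspace V) := by
  obtain ⟨Δ, Γ, h, hΔ⟩ := Contour.exists_isBoundaryOfCauchyDomain
    (spectrum.isCompact (𝕜 := ℂ) (Complexification.extend T)) hU
    ((Complexification.spectrum_extend_subset T).trans hT)
  have hflat := flat_rieszDunford hU hUconj hF hFconj (Complexification.flat_extend T) h hΔ
  exact ⟨⟨Δ, Γ, h, hΔ⟩, Γ.rieszDunford F (Complexification.extend T),
    fun Δ' Γ' h' hΔ' => Contour.rieszDunford_eq hU hF h' hΔ' h hΔ, hflat,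
    Complexification.mapsTo_realSubspace hflat⟩
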